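/- Let $S>0$, let $M=(m_{ij})$ be a real $2\times 2$ matrix with $\det M>0$, and let $q,\tilde q\in L^2(-S,S)$ be real-valued. For $\lambda\in\mathbb C$ consider the equation $$-y''+q(x)y=\lambda y\quad\text{on }[-S,0)\cup(0,S],\qquad \begin{pmatrix}y(0^+)\\ y'(0^+)\end{pmatrix}=M\begin{pmatrix}y(0^-)\\ y'(0^-)\end{pmatrix},$$ where solutions have $y,y'$ (locally) absolutely continuous on each of $[-S,0)$ and $(0,S]$, satisfy the equation almost everywhere, and have one-sided limits $y(0^\pm),y'(0^\pm)$. Let $w_1(\cdot,\lambda),w_2(\cdot,\lambda)$ be the solutions with $w_1(-S)=-1$, $w_1'(-S)=0$, $w_2(-S)=0$, $w_2'(-S)=1$. The Titchmarsh–Weyl $m$-function of the problem with Dirichlet conditions $y(-S)=0=y(S)$ is the meromorphic function $m$ whose value $m(\lambda)$, for every $\lambda$ with $w_2(S,\lambda)\neq 0$ (i.e. $\lambda$ not an eigenvalue), is the number for which $\psi=w_1+m(\lambda)w_2$ satisfies $\psi(S,\lambda)=0$. Let $\tilde m$ be the $m$-function of the same problem (same $S$ and $M$) with $q$ replaced by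 $\tilde q$. If $m=\tilde m$, then $q=\tilde q$ almost everywhere on $[-S,S]$. -/

import Mathlib

open MeasureTheory Set Filter Topology

/-- The pair `(y, y')` solves `-y'' + q y = lam y` on the interval `I`, in the Carathéodory sense:
`y'` is the derivative of `y` on `I` (one-sided at an end point that belongs to `I`), `y'` is
absolutely continuous on every compact subinterval of `I`, and the equation holds a.e. on `I`. -/
def SolvesSLOn (q : ℝ → ℝ) (lam : ℂ) (I : Set ℝ) (y y' : ℝ → ℂ) : Prop :=
  (∀ x ∈ I, HasDerivWithinAt y (y' x) I x) ∧
  (∀ a ∈ I, ∀ b ∈ I, AbsolutelyContinuousOnInterval y' a b) ∧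
  (∀ᵐ x ∂(volume.restrict I), ∃ y'' : ℂ,
    HasDerivWithinAt y' y'' I x ∧ -y'' + (q x : ℂ) * y x = lam * y x)

/-- The transfer condition `(y(0⁺), y'(0⁺))ᵀ = M (y(0⁻), y'(0⁻))ᵀ`; the four one-sided limits are
required to exist. -/
def TransferCondition (M : Matrix (Fin 2) (Fin 2) ℝ) (y y' : ℝ → ℂ) : Prop :=
  ∃ l l' r r' : ℂ,
    Tendsto y (𝓝[<] 0) (𝓝 l) ∧ Tendsto y' (𝓝[<] 0) (𝓝 l') ∧
    Tendsto y (𝓝[>] 0) (𝓝 r) ∧ Tendsto y' (𝓝[>] 0) (𝓝 r') ∧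
    r = (M 0 0 : ℂ) * l + (M 0 1 : ℂ) * l' ∧
    r' = (M 1 0 : ℂ) * l + (M 1 1 : ℂ) * l'

/-- `(y, y')` solves `-y'' + q y = lam y` on `[-S, 0) ∪ (0, S]` with the transfer condition at `0`.
The values of `y` and `y'` at `0` and outside `[-S, S]` play no role. -/
structure IsTransferSolution (S : ℝ) (M : Matrix (Fin 2) (Fin 2) ℝ) (q : ℝ → ℝ) (lam : ℂ)
    (y y' : ℝ → ℂ) : Prop where
  left : SolvesSLOn q lam (Ico (-S) 0) y y'
  right : SolvesSLOn q lam (Ioc 0 S) y y'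
  transfer : TransferCondition M y y'

/-- `m` is the Titchmarsh-Weyl m-function of `-y'' + q y = lam y` on `[-S, S]` with the transfer
condition given by `M` at `0` and Dirichlet conditions `y(-S) = 0 = y(S)`. Here `w₁`, `w₂` are the
solutions with `w₁(-S) = -1`, `w₁'(-S) = 0`, `w₂(-S) = 0`, `w₂'(-S) = 1`, and `m(lam)` is the
number for which `ψ = w₁ + m(lam) w₂` satisfies `ψ(S) = 0`. The zeros of `lam ↦ w₂(S, lam)` are the
Dirichlet eigenvalues; these are the poles of the m-function, and the value of `m` at them is
unconstrained. -/
def IsTitchmarshWeylM (S : ℝ) (M : Matrix (Fin 2) (Fin 2) ℝ) (q : ℝ → ℝ) (m : ℂ → ℂ) : Prop :=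
  ∀ (lam : ℂ) (w₁ w₁' w₂ w₂' : ℝ → ℂ),
    IsTransferSolution S M q lam w₁ w₁' → w₁ (-S) = -1 → w₁' (-S) = 0 →
    IsTransferSolution S M q lam w₂ w₂' → w₂ (-S) = 0 → w₂' (-S) = 1 →
    w₂ S ≠ 0 → w₁ S + m lam * w₂ S = 0

/-! ### Absolutely continuous complex functions -/

/-! Write λ = -k² with Re k ≥ 0, let a tilde mark the objects of q̃, and for fixed x put P(λ) = w₂
w̃₁ - w₁ w̃₂. The heart of the proof is that P vanishes identically (`cross_products_eq_zero`).

P is entire in λ, because solutions are sums of Picard series, and it is at most C exp(C|k|) for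
large |k|. Since the two problems share m, the terms in m cancel and P = w₂ ψ̃ - ψ w̃₂ with the Weyl
solutions ψ, ψ̃. As Re k → ∞, w₂ = O(e^{Re k (x+S)}/|k|) and ψ = O(e^{-Re k (x+S)}) on the left
half, so P = O(1/|k|). On the imaginary λ-axis Re k → ∞ as |λ| → ∞, so P is bounded there.
Phragmén-Lindelöf in the two half-planes and then Liouville make P constant, and the constant is 0
(`eq_zero_of_growth_of_tendsto`).

The decay of ψ comes from its Wronskian with w₂, which gives ψ'(S) w₂(S) = det M. A lower bound for
w₂(S) (`TSol.eventually_le_norm_right`) is thus an upper bound for ψ'(S), and estimates run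
backwards from S (`TSol.backward_bound`) spread it over the interval. A nonzero entry `M 0 1`
amplifies solutions by a factor of order |k|. On the right half this factor enlarges w₂ and shrinks
ψ, so it cancels in P.

Finally, P = 0 says that w₂/w₁ is the same for both potentials, and a ratio of independent solutions
determines the potential through its Schwarzian derivative. `SLSol.potential_ae_eq` is the
division-free form of this. -/

theorem IntervalIntegrable.mono_Icc {E : Type*} [NormedAddCommGroup E] {f : ℝ → E} {a b c d : ℝ}
    (hf : IntervalIntegrable f volume a b) (hc : c ∈ Icc a b) (hd : d ∈ Icc a b) :
    IntervalIntegrable f volume c d := by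
  have hab : a ≤ b := hc.1.trans hc.2
  refine hf.mono_set ?_
  rw [uIcc_of_le hab]
  exact uIcc_subset_Icc hc hd

/-- Real and imaginary parts are primitives of integrable real functions, and |z| ≤ |Re z| + |Im z|,
so ε/2 for each part suffices. -/
theorem AbsolutelyContinuousOnInterval.intervalIntegral_complex {g : ℝ → ℂ} {a b : ℝ}
    (hab : a ≤ b) (hg : IntervalIntegrable g volume a b) :
    AbsolutelyContinuousOnInterval (fun x => ∫ t in a..x, g t) a b := by
  have hre : IntervalIntegrable (fun t => (g t).re) volume a b :=
    ⟨hg.1.re, hg.2.re⟩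
  have him : IntervalIntegrable (fun t => (g t).im) volume a b :=
    ⟨hg.1.im, hg.2.im⟩
  have h1 := hre.absolutelyContinuousOnInterval_intervalIntegral left_mem_uIcc
  have h2 := him.absolutelyContinuousOnInterval_intervalIntegral left_mem_uIcc
  rw [absolutelyContinuousOnInterval_iff] at h1 h2 ⊢
  intro ε hε
  obtain ⟨d1, hd1, H1⟩ := h1 (ε / 2) (by positivity)
  obtain ⟨d2, hd2, H2⟩ := h2 (ε / 2) (by positivity)
  refine ⟨min d1 d2, lt_min hd1 hd2, fun E hE hlt => ?_⟩
  have e1 := H1 E hE (hlt.trans_le (min_le_left _ _))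
  have e2 := H2 E hE (hlt.trans_le (min_le_right _ _))
  refine lt_of_le_of_lt ?_ ((add_lt_add e1 e2).trans_eq (by ring))
  rw [← Finset.sum_add_distrib]
  refine Finset.sum_le_sum fun i hi => ?_
  obtain ⟨m1, m2⟩ := hE.1 i hi
  rw [uIcc_of_le hab] at m1 m2
  have key : ∀ x ∈ Icc a b, (∫ t in a..x, g t).re = ∫ t in a..x, (g t).re := fun x hx => by
    have := hg.mono_Icc (left_mem_Icc.2 hab) hx
    have h := Complex.reCLM.intervalIntegral_comp_comm this
    simpa using h.symm
  have key' : ∀ x ∈ Icc a b, (∫ t in a..x, g t).im = ∫ t in a..x, (g t).im := fun x hx => by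
    have := hg.mono_Icc (left_mem_Icc.2 hab) hx
    have h := Complex.imCLM.intervalIntegral_comp_comm this
    simpa using h.symm
  rw [Complex.dist_eq, Real.dist_eq, Real.dist_eq, ← key _ m1, ← key _ m2,
    ← key' _ m1, ← key' _ m2, ← Complex.sub_re, ← Complex.sub_im]
  exact Complex.norm_le_abs_re_add_abs_im _

theorem AbsolutelyContinuousOnInterval.congr {f g : ℝ → ℂ} {a b : ℝ}
    (hf : AbsolutelyContinuousOnInterval f a b) (h : ∀ x ∈ uIcc a b, f x = g x) :
    AbsolutelyContinuousOnInterval g a b := by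
  rw [absolutelyContinuousOnInterval_iff] at hf ⊢
  intro ε hε
  obtain ⟨d, hd, H⟩ := hf ε hε
  refine ⟨d, hd, fun E hE hlt => ?_⟩
  refine lt_of_eq_of_lt (Finset.sum_congr rfl fun i hi => ?_) (H E hE hlt)
  rw [h _ (hE.1 i hi).1, h _ (hE.1 i hi).2]

theorem AbsolutelyContinuousOnInterval.const {a b : ℝ} (c : ℂ) :
    AbsolutelyContinuousOnInterval (fun _ => c) a b := by
  simpa [AbsolutelyContinuousOnInterval] using tendsto_const_nhds

theorem ae_mem_Ioo_imp_of_Icc {a b : ℝ} {p : ℝ → Prop} (h : ∀ᵐ x : ℝ, x ∈ Ioo a b → p x) :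
    ∀ᵐ x : ℝ, x ∈ Icc a b → p x := by
  have h₁ : ∀ᵐ x : ℝ, x ≠ a := by simp [ae_iff, measure_singleton]
  have h₂ : ∀ᵐ x : ℝ, x ≠ b := by simp [ae_iff, measure_singleton]
  filter_upwards [h, h₁, h₂] with x hx h1 h2 hm
  exact hx ⟨lt_of_le_of_ne hm.1 (Ne.symm h1), lt_of_le_of_ne hm.2 h2⟩

/-- The fundamental theorem of calculus for absolutely continuous complex functions. -/
theorem AbsolutelyContinuousOnInterval.integral_eq_sub_of_ae_hasDerivAt {f g : ℝ → ℂ} {a b x : ℝ}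
    (hf : AbsolutelyContinuousOnInterval f a b) (hg : IntervalIntegrable g volume a b)
    (hd : ∀ᵐ x, x ∈ Ioo a b → HasDerivAt f (g x) x) (hx : x ∈ Icc a b) :
    f x = f a + ∫ t in a..x, g t := by
  have hab : a ≤ b := hx.1.trans hx.2
  have hI := AbsolutelyContinuousOnInterval.intervalIntegral_complex hab hg
  obtain ⟨C, hC⟩ := (hf.sub hI).const_of_ae_hasDerivAt_zero (by
    have h := ae_mem_Ioo_imp_of_Icc hd
    rw [uIcc_of_le hab]
    have h2 := hg.ae_hasDerivAt_integral
    rw [uIcc_of_le hab] at h2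
    filter_upwards [h, h2] with y hy hy2 hm
    simpa using (hy hm).sub (hy2 hm a (left_mem_Icc.2 hab)))
  rw [uIcc_of_le hab] at hC
  have h1 := hC x hx
  have h2 := hC a (left_mem_Icc.2 hab)
  simp only [Pi.sub_apply, intervalIntegral.integral_same, sub_zero] at h1 h2
  rw [h2, ← h1]; ring

/-! ### Holomorphic dependence of integrals on a parameter -/

/-- Differentiation under the integral needs a dominated z-derivative. Holomorphy supplies it:
Cauchy's estimate turns a bound on F into a bound on its derivative. -/
theorem differentiable_intervalIntegral_of_locally_bounded {F : ℂ → ℝ → ℂ} {a b : ℝ}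
    (hab : a ≤ b)
    (hm : ∀ z, AEStronglyMeasurable (F z) (volume.restrict (Ioc a b)))
    (hd : ∀ t ∈ Ioc a b, Differentiable ℂ fun z => F z t)
    (hb : ∀ R : ℝ, ∃ g : ℝ → ℝ, IntervalIntegrable g volume a b ∧
      ∀ z : ℂ, ‖z‖ ≤ R → ∀ t ∈ Ioc a b, ‖F z t‖ ≤ g t) :
    Differentiable ℂ fun z => ∫ t in a..b, F z t := by
  intro z₀
  -- Radius + 2: z ranges over the unit ball about z₀, and Cauchy's estimate uses the unit circle
  -- about z.
  obtain ⟨g, hg, hFg⟩ := hb (‖z₀‖ + 2)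
  have huI : uIoc a b = Ioc a b := uIoc_of_le hab
  have := (intervalIntegral.hasDerivAt_integral_of_dominated_loc_of_deriv_le (μ := volume)
    (a := a) (b := b) (F := F) (F' := fun z t => deriv (fun z => F z t) z) (x₀ := z₀)
    (bound := g) (Metric.ball_mem_nhds z₀ one_pos) (Eventually.of_forall fun z => by
      rw [huI]; exact hm z) ?_ ?_ ?_ hg ?_).2
  · exact this.differentiableAt
  · refine hg.mono_fun ?_ ?_
    · rw [huI]; exact hm z₀
    · rw [huI]
      refine (ae_restrict_iff' measurableSet_Ioc).2 (Eventually.of_forall fun t ht => ?_)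
      exact (hFg z₀ (by linarith) t ht).trans (le_abs_self _)
  · rw [huI]
    -- The derivative is measurable in t as a limit of difference quotients with increments 1/(n+1).
    refine aestronglyMeasurable_of_tendsto_ae (atTop : Filter ℕ)
      (f := fun (n : ℕ) t => ((1 / ((n : ℂ) + 1)))⁻¹ • (F (z₀ + 1 / ((n : ℂ) + 1)) t - F z₀ t)) ?_ ?_
    · exact fun n => ((hm (z₀ + 1 / ((n : ℂ) + 1))).sub (hm z₀)).const_smul
        ((1 / ((n : ℂ) + 1)))⁻¹
    · refine (ae_restrict_iff' measurableSet_Ioc).2 (Eventually.of_forall fun t ht => ?_)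
      have h := ((hd t ht) z₀).hasDerivAt.tendsto_slope_zero
      refine h.comp (tendsto_nhdsWithin_iff.2 ⟨?_, Eventually.of_forall fun n => ?_⟩)
      · exact tendsto_one_div_add_atTop_nhds_zero_nat
      · simp only [mem_compl_iff, mem_singleton_iff]
        exact one_div_ne_zero (Nat.cast_add_one_ne_zero n)
  · refine Eventually.of_forall fun t ht z hz => ?_
    rw [huI] at ht
    have := Complex.norm_deriv_le_of_forall_mem_sphere_norm_le (F := ℂ) (c := z) (R := 1)
      (C := g t) (f := fun z => F z t) one_pos (hd t ht).diffContOnCl fun w hw => by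
        refine hFg w ?_ t ht
        have h1 : ‖w - z‖ = 1 := by simpa [dist_eq_norm] using hw
        have h2 : ‖z - z₀‖ < 1 := by simpa [dist_eq_norm] using hz
        calc ‖w‖ = ‖(w - z) + (z - z₀) + z₀‖ := by congr 1; ring
          _ ≤ ‖w - z‖ + ‖z - z₀‖ + ‖z₀‖ := norm_add₃_le
          _ ≤ _ := by linarith
    simpa using this
  · refine Eventually.of_forall fun t ht z hz => ?_
    rw [huI] at ht
    exact ((hd t ht) z).hasDerivAt

/-! ### Picard iteration for `y'' = r y` -/

/-- Picard iterates of the integral equation `y = f + ∫∫ r y`. -/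
noncomputable def picardIter (r : ℝ → ℂ) (a : ℝ) (f : ℝ → ℂ) : ℕ → ℝ → ℂ
  | 0 => f
  | n + 1 => fun x => ∫ s in a..x, ∫ t in a..s, r t * picardIter r a f n t

section Picard

variable {r : ℝ → ℂ} {a b : ℝ} {f : ℝ → ℂ}

theorem continuousOn_primitive_Icc {g : ℝ → ℂ} (hab : a ≤ b)
    (hg : IntervalIntegrable g volume a b) :
    ContinuousOn (fun x => ∫ t in a..x, g t) (Icc a b) := by
  have := intervalIntegral.continuousOn_primitive_interval' hg left_mem_uIcc
  rwa [uIcc_of_le hab] at this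

theorem IntervalIntegrable.mul_continuousOn_Icc (hab : a ≤ b)
    (hr : IntervalIntegrable r volume a b) (hf : ContinuousOn f (Icc a b)) :
    IntervalIntegrable (fun t => r t * f t) volume a b :=
  hr.mul_continuousOn (by rwa [uIcc_of_le hab])

theorem ContinuousOn.intervalIntegrable_Icc' (hab : a ≤ b) (hf : ContinuousOn f (Icc a b)) :
    IntervalIntegrable f volume a b :=
  ContinuousOn.intervalIntegrable (by rwa [uIcc_of_le hab])

theorem picardIter_continuousOn (hab : a ≤ b) (hr : IntervalIntegrable r volume a b)
    (hf : ContinuousOn f (Icc a b)) (n : ℕ) : ContinuousOn (picardIter r a f n) (Icc a b) := by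
  induction n with
  | zero => exact hf
  | succ n ih =>
    exact continuousOn_primitive_Icc hab (ContinuousOn.intervalIntegrable_Icc' hab
      (continuousOn_primitive_Icc hab (hr.mul_continuousOn_Icc hab ih)))

theorem norm_integral_mul_le_of_bound {y : ℝ → ℂ} {K B s : ℝ}
    (hr : IntervalIntegrable r volume a b) (hK : ∫ t in a..b, ‖r t‖ ≤ K)
    (hs : s ∈ Icc a b) (hB : 0 ≤ B) (hy : ∀ t ∈ Ioc a s, ‖y t‖ ≤ B) :
    ‖∫ t in a..s, r t * y t‖ ≤ K * B := by
  have hab : a ≤ b := hs.1.trans hs.2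
  have hr' := (hr.mono_Icc (left_mem_Icc.2 hab) hs).norm
  calc ‖∫ t in a..s, r t * y t‖ ≤ ∫ t in a..s, ‖r t‖ * B := by
        refine intervalIntegral.norm_integral_le_of_norm_le hs.1
          (Eventually.of_forall fun t ht => ?_) (hr'.mul_const B)
        rw [norm_mul]
        exact mul_le_mul_of_nonneg_left (hy t ht) (norm_nonneg _)
    _ = (∫ t in a..s, ‖r t‖) * B := intervalIntegral.integral_mul_const _ _
    _ ≤ (∫ t in a..b, ‖r t‖) * B := by
        refine mul_le_mul_of_nonneg_right ?_ hB
        exact intervalIntegral.integral_mono_interval le_rfl hs.1 hs.2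
          (Eventually.of_forall fun t => norm_nonneg _) hr.norm
    _ ≤ K * B := mul_le_mul_of_nonneg_right hK hB

/-- The inner integral costs a factor K, as the previous bound increases in t and can be pulled out.
Only the outer integral raises the power of x - a and produces the factorial. -/
theorem picardIter_bound {K C : ℝ} (hr : IntervalIntegrable r volume a b)
    (hK : ∫ t in a..b, ‖r t‖ ≤ K) (hC : ∀ x ∈ Icc a b, ‖f x‖ ≤ C) (n : ℕ) :
    ∀ x ∈ Icc a b, ‖picardIter r a f n x‖ ≤ C * K ^ n * ((x - a) ^ n / n.factorial) := by
  induction n with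
  | zero => simpa [picardIter] using hC
  | succ n ih =>
    intro x hx
    have hab : a ≤ b := hx.1.trans hx.2
    have hC0 : 0 ≤ C := (norm_nonneg _).trans (hC x hx)
    have hK0 : 0 ≤ K :=
      (intervalIntegral.integral_nonneg hab fun t _ => norm_nonneg (r t)).trans hK
    have key : ∀ s ∈ Ioc a x, ‖∫ t in a..s, r t * picardIter r a f n t‖ ≤
        C * K ^ (n + 1) * ((s - a) ^ n / n.factorial) := by
      intro s hs
      have h0 : 0 ≤ s - a := sub_nonneg.2 hs.1.le
      refine (norm_integral_mul_le_of_bound (B := C * K ^ n * ((s - a) ^ n / n.factorial)) hr hK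
        ⟨hs.1.le, hs.2.trans hx.2⟩ (by positivity) fun t ht => ?_).trans_eq (by ring)
      have ht0 : 0 ≤ t - a := sub_nonneg.2 ht.1.le
      refine (ih t ⟨ht.1.le, ht.2.trans (hs.2.trans hx.2)⟩).trans ?_
      have : t - a ≤ s - a := by linarith [ht.2]
      gcongr
    have hI : IntervalIntegrable (fun s => C * K ^ (n + 1) * ((s - a) ^ n / n.factorial))
        volume a x := Continuous.intervalIntegrable (by fun_prop) _ _
    refine (intervalIntegral.norm_integral_le_of_norm_le hx.1
      (Eventually.of_forall key) hI).trans_eq ?_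
    rw [intervalIntegral.integral_const_mul, intervalIntegral.integral_div,
      intervalIntegral.integral_comp_sub_right (fun s => s ^ n) a, integral_pow]
    rw [Nat.factorial_succ]
    push_cast
    have : (n.factorial : ℝ) ≠ 0 := by positivity
    have : (n : ℝ) + 1 ≠ 0 := by positivity
    field_simp
    simp

/-- The solution of `y = f + ∫∫ r y` as the sum of the Picard iterates. -/
noncomputable def picardSol (r : ℝ → ℂ) (a : ℝ) (f : ℝ → ℂ) (x : ℝ) : ℂ :=
  ∑' n, picardIter r a f n x

theorem summable_picard_majorant (C K L : ℝ) :
    Summable fun n : ℕ => C * K ^ n * (L ^ n / n.factorial) := by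
  have := (Real.summable_pow_div_factorial (K * L)).mul_left C
  refine this.congr fun n => ?_
  rw [mul_pow]; ring

theorem picardIter_bound' {K C : ℝ} (hr : IntervalIntegrable r volume a b)
    (hK : ∫ t in a..b, ‖r t‖ ≤ K) (hC : ∀ x ∈ Icc a b, ‖f x‖ ≤ C) (n : ℕ) :
    ∀ x ∈ Icc a b, ‖picardIter r a f n x‖ ≤ C * K ^ n * ((b - a) ^ n / n.factorial) := by
  intro x hx
  have hab : a ≤ b := hx.1.trans hx.2
  have hC0 : 0 ≤ C := (norm_nonneg _).trans (hC x hx)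
  have hK0 : 0 ≤ K :=
    (intervalIntegral.integral_nonneg hab fun t _ => norm_nonneg (r t)).trans hK
  refine (picardIter_bound hr hK hC n x hx).trans ?_
  have h1 : x - a ≤ b - a := by linarith [hx.2]
  have h2 : 0 ≤ x - a := sub_nonneg.2 hx.1
  gcongr

theorem picardSol_bound {K C : ℝ} (hr : IntervalIntegrable r volume a b)
    (hK : ∫ t in a..b, ‖r t‖ ≤ K) (hC : ∀ x ∈ Icc a b, ‖f x‖ ≤ C) :
    ∀ x ∈ Icc a b, ‖picardSol r a f x‖ ≤ ∑' n : ℕ, C * K ^ n * ((b - a) ^ n / n.factorial) :=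
  fun x hx => tsum_of_norm_bounded (summable_picard_majorant _ _ _).hasSum
    fun n => picardIter_bound' hr hK hC n x hx

theorem picardSol_continuousOn (hab : a ≤ b) (hr : IntervalIntegrable r volume a b)
    (hf : ContinuousOn f (Icc a b)) : ContinuousOn (picardSol r a f) (Icc a b) := by
  obtain ⟨C, hC⟩ := isCompact_Icc.exists_bound_of_continuousOn hf
  exact continuousOn_tsum (picardIter_continuousOn hab hr hf) (summable_picard_majorant _ _ _)
    fun n x hx => picardIter_bound' hr le_rfl hC n x hx

/-- Dominated convergence allows integrating the series termwise, first in the inner and then in the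
outer integral. This shifts the index by one, and the missing zeroth term is f. -/
theorem picardSol_eq (hab : a ≤ b) (hr : IntervalIntegrable r volume a b)
    (hf : ContinuousOn f (Icc a b)) {x : ℝ} (hx : x ∈ Icc a b) :
    picardSol r a f x = f x + ∫ s in a..x, ∫ t in a..s, r t * picardSol r a f t := by
  obtain ⟨C, hC⟩ := isCompact_Icc.exists_bound_of_continuousOn hf
  set K := ∫ t in a..b, ‖r t‖ with hKdef
  have hK0 : 0 ≤ K := intervalIntegral.integral_nonneg hab fun t _ => norm_nonneg (r t)
  have hC0 : 0 ≤ C := (norm_nonneg _).trans (hC x hx)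
  have hba : 0 ≤ b - a := sub_nonneg.2 hab
  have hsum : ∀ t ∈ Icc a b, Summable fun n => picardIter r a f n t := fun t ht =>
    Summable.of_norm_bounded (summable_picard_majorant C K (b - a))
      fun n => picardIter_bound' hr le_rfl hC n t ht
  have inner : ∀ s ∈ Icc a b, HasSum (fun n => ∫ t in a..s, r t * picardIter r a f n t)
      (∫ t in a..s, r t * picardSol r a f t) := by
    intro s hs
    have hsub : uIoc a s ⊆ Icc a b := by
      rw [uIoc_of_le hs.1]; exact fun t ht => ⟨ht.1.le, ht.2.trans hs.2⟩
    have hrs := hr.mono_Icc (left_mem_Icc.2 hab) hs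
    refine intervalIntegral.hasSum_integral_of_dominated_convergence
      (fun n t => ‖r t‖ * (C * K ^ n * ((b - a) ^ n / n.factorial))) (fun n => ?_) (fun n => ?_)
      ?_ ?_ ?_
    · exact ((hr.mul_continuousOn_Icc hab (picardIter_continuousOn hab hr hf n)).mono_Icc
        (left_mem_Icc.2 hab) hs).aestronglyMeasurable_restrict_uIoc
    · refine Eventually.of_forall fun t ht => ?_
      rw [norm_mul]
      exact mul_le_mul_of_nonneg_left (picardIter_bound' hr le_rfl hC n t (hsub ht))
        (norm_nonneg _)
    · exact Eventually.of_forall fun t _ => (summable_picard_majorant _ _ _).mul_left _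
    · simp_rw [tsum_mul_left]
      exact hrs.norm.mul_const _
    · exact Eventually.of_forall fun t ht => ((hsum t (hsub ht)).hasSum).mul_left _
  have outer : HasSum (fun n => ∫ s in a..x, ∫ t in a..s, r t * picardIter r a f n t)
      (∫ s in a..x, ∫ t in a..s, r t * picardSol r a f t) := by
    have hsub : uIoc a x ⊆ Icc a b := by
      rw [uIoc_of_le hx.1]; exact fun t ht => ⟨ht.1.le, ht.2.trans hx.2⟩
    refine intervalIntegral.hasSum_integral_of_dominated_convergence
      (fun n _ => K * (C * K ^ n * ((b - a) ^ n / n.factorial))) (fun n => ?_) (fun n => ?_)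
      ?_ ?_ ?_
    · have := (continuousOn_primitive_Icc hab (hr.mul_continuousOn_Icc hab
        (picardIter_continuousOn hab hr hf n))).intervalIntegrable_Icc' hab
      exact (this.mono_Icc (left_mem_Icc.2 hab) hx).aestronglyMeasurable_restrict_uIoc
    · refine Eventually.of_forall fun s hs => ?_
      refine norm_integral_mul_le_of_bound hr le_rfl (hsub hs) (by positivity) fun t ht => ?_
      exact picardIter_bound' hr le_rfl hC n t ⟨ht.1.le, ht.2.trans (hsub hs).2⟩
    · exact Eventually.of_forall fun t _ => (summable_picard_majorant _ _ _).mul_left _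
    · exact intervalIntegrable_const
    · exact Eventually.of_forall fun t ht => inner t (hsub ht)
  have h0 := (hsum x hx).tsum_eq_zero_add
  rw [picardSol, h0]
  congr 1
  exact outer.tsum_eq

theorem picardIter_differentiable {r : ℂ → ℝ → ℂ} {f : ℂ → ℝ → ℂ}
    (hr : ∀ z, IntervalIntegrable (r z) volume a b)
    (hrd : ∀ t, Differentiable ℂ fun z => r z t)
    (hrb : ∀ R : ℝ, ∃ g : ℝ → ℝ, IntervalIntegrable g volume a b ∧
      ∀ z : ℂ, ‖z‖ ≤ R → ∀ t, ‖r z t‖ ≤ g t)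
    (hf : ∀ z, ContinuousOn (f z) (Icc a b)) (hfd : ∀ t, Differentiable ℂ fun z => f z t)
    (hfb : ∀ R : ℝ, ∃ C : ℝ, ∀ z : ℂ, ‖z‖ ≤ R → ∀ t ∈ Icc a b, ‖f z t‖ ≤ C) (n : ℕ) :
    ∀ x ∈ Icc a b, Differentiable ℂ fun z => picardIter (r z) a (f z) n x := by
  induction n with
  | zero => exact fun x _ => hfd x
  | succ n ih =>
    intro x hx
    have hab : a ≤ b := hx.1.trans hx.2
    have hbd : ∀ R : ℝ, ∃ B : ℝ, 0 ≤ B ∧ ∀ z : ℂ, ‖z‖ ≤ R → ∀ t ∈ Icc a b,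
        ‖picardIter (r z) a (f z) n t‖ ≤ B := by
      intro R
      obtain ⟨g, hg, hrg⟩ := hrb R
      obtain ⟨C, hC⟩ := hfb R
      refine ⟨max 0 (C * (∫ t in a..b, g t) ^ n * ((b - a) ^ n / n.factorial)), le_max_left _ _,
        fun z hz t ht => le_max_of_le_right ?_⟩
      refine picardIter_bound' (hr z) ?_ (hC z hz) n t ht
      exact intervalIntegral.integral_mono_on hab (hr z).norm hg fun t _ => hrg z hz t
    have inner : ∀ s ∈ Icc a b, Differentiable ℂ fun z =>
        ∫ t in a..s, r z t * picardIter (r z) a (f z) n t := by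
      intro s hs
      refine differentiable_intervalIntegral_of_locally_bounded hs.1 (fun z => ?_)
        (fun t ht => ?_) (fun R => ?_)
      · exact (((hr z).mul_continuousOn_Icc hab (picardIter_continuousOn hab (hr z) (hf z)
          n)).mono_Icc (left_mem_Icc.2 hab) hs).1.aestronglyMeasurable
      · exact (hrd t).mul (ih t ⟨ht.1.le, ht.2.trans hs.2⟩)
      · obtain ⟨g, hg, hrg⟩ := hrb R
        obtain ⟨B, hB0, hB⟩ := hbd R
        refine ⟨fun t => g t * B, (hg.mono_Icc (left_mem_Icc.2 hab) hs).mul_const B,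
          fun z hz t ht => ?_⟩
        rw [norm_mul]
        exact mul_le_mul (hrg z hz t) (hB z hz t ⟨ht.1.le, ht.2.trans hs.2⟩) (norm_nonneg _)
          ((norm_nonneg _).trans (hrg z hz t))
    refine differentiable_intervalIntegral_of_locally_bounded hx.1 (fun z => ?_)
        (fun s hs => inner s ⟨hs.1.le, hs.2.trans hx.2⟩) (fun R => ?_)
    · have := (continuousOn_primitive_Icc hab ((hr z).mul_continuousOn_Icc hab
        (picardIter_continuousOn hab (hr z) (hf z) n))).intervalIntegrable_Icc' hab
      exact (this.mono_Icc (left_mem_Icc.2 hab) hx).1.aestronglyMeasurable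
    · obtain ⟨g, hg, hrg⟩ := hrb R
      obtain ⟨B, hB0, hB⟩ := hbd R
      refine ⟨fun _ => (∫ t in a..b, g t) * B, intervalIntegrable_const, fun z hz s hs => ?_⟩
      refine norm_integral_mul_le_of_bound (hr z) ?_ ⟨hs.1.le, hs.2.trans hx.2⟩ hB0
        fun t ht => hB z hz t ⟨ht.1.le, ht.2.trans (hs.2.trans hx.2)⟩
      exact intervalIntegral.integral_mono_on hab (hr z).norm hg fun t _ => hrg z hz t

/-- On each ball the entire iterates have a summable majorant independent of z, so Weierstrass'
theorem applies. -/
theorem picardSol_differentiable {r : ℂ → ℝ → ℂ} {f : ℂ → ℝ → ℂ}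
    (hr : ∀ z, IntervalIntegrable (r z) volume a b)
    (hrd : ∀ t, Differentiable ℂ fun z => r z t)
    (hrb : ∀ R : ℝ, ∃ g : ℝ → ℝ, IntervalIntegrable g volume a b ∧
      ∀ z : ℂ, ‖z‖ ≤ R → ∀ t, ‖r z t‖ ≤ g t)
    (hf : ∀ z, ContinuousOn (f z) (Icc a b)) (hfd : ∀ t, Differentiable ℂ fun z => f z t)
    (hfb : ∀ R : ℝ, ∃ C : ℝ, ∀ z : ℂ, ‖z‖ ≤ R → ∀ t ∈ Icc a b, ‖f z t‖ ≤ C)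
    {x : ℝ} (hx : x ∈ Icc a b) : Differentiable ℂ fun z => picardSol (r z) a (f z) x := by
  have hab : a ≤ b := hx.1.trans hx.2
  intro z₀
  obtain ⟨g, hg, hrg⟩ := hrb (‖z₀‖ + 1)
  obtain ⟨C, hC⟩ := hfb (‖z₀‖ + 1)
  have hU : IsOpen (Metric.ball (0 : ℂ) (‖z₀‖ + 1)) := Metric.isOpen_ball
  have h := Complex.differentiableOn_tsum_of_summable_norm
    (F := fun n z => picardIter (r z) a (f z) n x)
    (summable_picard_majorant C (∫ t in a..b, g t) (b - a))
    (fun n => (picardIter_differentiable hr hrd hrb hf hfd hfb n x hx).differentiableOn) hU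
    (fun n z hz => by
      have hz' : ‖z‖ ≤ ‖z₀‖ + 1 := by simpa using (mem_ball_zero_iff.1 hz).le
      exact picardIter_bound' (hr z) (intervalIntegral.integral_mono_on hab (hr z).norm hg
        fun t _ => hrg z hz' t) (hC z hz') n x hx)
  exact h.differentiableAt (hU.mem_nhds (by simp))

end Picard

/-! ### Solutions of the Sturm-Liouville equation on a compact interval -/

/-- `(y, y')` solves `-y'' + q y = lam y` on the compact interval `[a, b]`. -/
structure SLSol (q : ℝ → ℝ) (lam : ℂ) (a b : ℝ) (y y' : ℝ → ℂ) : Prop where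
  hasDeriv : ∀ x ∈ Icc a b, HasDerivWithinAt y (y' x) (Icc a b) x
  ac : AbsolutelyContinuousOnInterval y' a b
  ae : ∀ᵐ x, x ∈ Ioo a b → HasDerivAt y' (((q x : ℂ) - lam) * y x) x

namespace AbsolutelyContinuousOnInterval

theorem mul_complex {f g : ℝ → ℂ} {a b : ℝ} (hf : AbsolutelyContinuousOnInterval f a b)
    (hg : AbsolutelyContinuousOnInterval g a b) :
    AbsolutelyContinuousOnInterval (fun x => f x * g x) a b := by
  simpa using hf.fun_smul hg

theorem of_hasDerivWithinAt {f f' : ℝ → ℂ} {a b : ℝ} (hab : a ≤ b)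
    (hf : ∀ x ∈ Icc a b, HasDerivWithinAt f (f' x) (Icc a b) x) (hf' : ContinuousOn f' (Icc a b)) :
    AbsolutelyContinuousOnInterval f a b := by
  obtain ⟨C, hC⟩ := isCompact_Icc.exists_bound_of_continuousOn hf'
  refine LipschitzOnWith.absolutelyContinuousOnInterval (K := C.toNNReal) ?_
  rw [uIcc_of_le hab]
  refine (convex_Icc a b).lipschitzOnWith_of_nnnorm_hasDerivWithin_le hf fun x hx => ?_
  rw [← NNReal.coe_le_coe, coe_nnnorm]
  exact (hC x hx).trans (Real.le_coe_toNNReal C)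

end AbsolutelyContinuousOnInterval

namespace SLSol

variable {q : ℝ → ℝ} {lam : ℂ} {a b : ℝ} {y y' z z' : ℝ → ℂ}

theorem continuousOn (h : SLSol q lam a b y y') : ContinuousOn y (Icc a b) :=
  fun x hx => (h.hasDeriv x hx).continuousWithinAt

theorem continuousOn' (hab : a ≤ b) (h : SLSol q lam a b y y') : ContinuousOn y' (Icc a b) := by
  have := h.ac.continuousOn
  rwa [uIcc_of_le hab] at this

theorem ac_left (hab : a ≤ b) (h : SLSol q lam a b y y') :
    AbsolutelyContinuousOnInterval y a b :=
  AbsolutelyContinuousOnInterval.of_hasDerivWithinAt hab h.hasDeriv (h.continuousOn' hab)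

theorem hasDerivAt (h : SLSol q lam a b y y') {x : ℝ} (hx : x ∈ Ioo a b) :
    HasDerivAt y (y' x) x :=
  (h.hasDeriv x (Ioo_subset_Icc_self hx)).hasDerivAt (Icc_mem_nhds hx.1 hx.2)

theorem add (hy : SLSol q lam a b y y') (hz : SLSol q lam a b z z') :
    SLSol q lam a b (fun x => y x + z x) (fun x => y' x + z' x) where
  hasDeriv x hx := (hy.hasDeriv x hx).add (hz.hasDeriv x hx)
  ac := hy.ac.fun_add hz.ac
  ae := by
    filter_upwards [hy.ae, hz.ae] with x h1 h2 hx
    exact ((h1 hx).add (h2 hx)).congr_deriv (by ring)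

theorem const_mul (c : ℂ) (hy : SLSol q lam a b y y') :
    SLSol q lam a b (fun x => c * y x) (fun x => c * y' x) where
  hasDeriv x hx := (hy.hasDeriv x hx).const_mul c
  ac := (AbsolutelyContinuousOnInterval.const c).mul_complex hy.ac
  ae := by
    filter_upwards [hy.ae] with x h1 hx
    exact ((h1 hx).const_mul c).congr_deriv (by ring)

theorem intervalIntegrable_potential (hq : IntervalIntegrable q volume a b) (lam : ℂ) :
    IntervalIntegrable (fun t => (q t : ℂ) - lam) volume a b := by
  have h1 : IntervalIntegrable (fun t => (q t : ℂ)) volume a b := ⟨hq.1.ofReal, hq.2.ofReal⟩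
  exact h1.sub intervalIntegrable_const

/-- The Wronskian is absolutely continuous and its derivative vanishes a.e., because both potential
terms cancel. -/
theorem wronskian_eq (hab : a ≤ b) (hy : SLSol q lam a b y y') (hz : SLSol q lam a b z z')
    {x : ℝ} (hx : x ∈ Icc a b) :
    y x * z' x - y' x * z x = y a * z' a - y' a * z a := by
  have hac : AbsolutelyContinuousOnInterval (fun x => y x * z' x - y' x * z x) a b :=
    ((hy.ac_left hab).mul_complex hz.ac).fun_sub (hy.ac.mul_complex (hz.ac_left hab))
  have := hac.integral_eq_sub_of_ae_hasDerivAt (g := fun _ => 0) intervalIntegrable_const ?_ hx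
  · simpa using this
  · filter_upwards [hy.ae, hz.ae] with t h1 h2 ht
    exact (((hy.hasDerivAt ht).mul (h2 ht)).sub ((h1 ht).mul (hz.hasDerivAt ht))).congr_deriv (by ring)

theorem reflect (hab : a ≤ b) (hq : IntervalIntegrable q volume a b)
    (h : SLSol q lam a b y y') :
    SLSol (fun x => q (-x)) lam (-b) (-a) (fun x => y (-x)) (fun x => -y' (-x)) where
  hasDeriv x hx := by
    have hx' : -x ∈ Icc a b := ⟨by linarith [hx.2], by linarith [hx.1]⟩
    have h2 : HasDerivWithinAt (fun x : ℝ => -x) (-1) (Icc (-b) (-a)) x :=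
      (hasDerivAt_neg x).hasDerivWithinAt
    have := (h.hasDeriv (-x) hx').scomp x h2 fun t ht => ⟨by linarith [ht.2], by linarith [ht.1]⟩
    simpa [Function.comp_def] using this
  ac := by
    have hg := (intervalIntegrable_potential hq lam).mul_continuousOn_Icc hab h.continuousOn
    have hg' : IntervalIntegrable (fun t => ((q (-t) : ℂ) - lam) * y (-t)) volume (-b) (-a) := by
      have h1 := IntervalIntegrable.comp_sub_left hg 0
      simpa using h1.symm
    -- Absolute continuity is read off from the integral formula -y'(-x) = -y'(b) + ∫ from -b to x
    -- of the reflected right-hand side.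
    refine ((AbsolutelyContinuousOnInterval.const (-y' b)).fun_add
      (AbsolutelyContinuousOnInterval.intervalIntegral_complex (by linarith) hg')).congr
      fun x hx => ?_
    rw [uIcc_of_le (by linarith)] at hx
    have hx' : -x ∈ Icc a b := ⟨by linarith [hx.2], by linarith [hx.1]⟩
    have e1 := h.ac.integral_eq_sub_of_ae_hasDerivAt hg h.ae hx'
    have e2 := h.ac.integral_eq_sub_of_ae_hasDerivAt hg h.ae (right_mem_Icc.2 hab)
    have e3 := intervalIntegral.integral_add_adjacent_intervals
      (hg.mono_Icc (left_mem_Icc.2 hab) hx') (hg.mono_Icc hx' (right_mem_Icc.2 hab))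
    have e4 : ∫ t in (-b)..x, ((q (-t) : ℂ) - lam) * y (-t) =
        ∫ t in (-x)..b, ((q t : ℂ) - lam) * y t := by
      simpa using intervalIntegral.integral_comp_neg (a := -b) (b := x)
        (fun t => ((q t : ℂ) - lam) * y t)
    rw [e4, e1, e2, ← e3]; ring
  ae := by
    have := (Measure.measurePreserving_neg (volume : Measure ℝ)).quasiMeasurePreserving.ae h.ae
    filter_upwards [this] with x hx hm
    have h1 := hx ⟨by linarith [hm.2], by linarith [hm.1]⟩
    have h2 : HasDerivAt (fun x => -y' (-x)) (-((-1 : ℝ) • (((q (-x) : ℂ) - lam) * y (-x)))) x :=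
      (h1.scomp x (hasDerivAt_neg x)).neg
    exact h2.congr_deriv (by simp)

/-! ### A priori estimates for large spectral parameter -/

/-- The coordinates y' ± k y diagonalise the free equation: e^{-kx}(y' + k y) and e^{kx}(y' - k y)
have derivatives q e^{-kx} y and q e^{kx} y. The potential therefore enters only through y, which is
recovered with a gain from 2 k y = (y' + k y) - (y' - k y). -/
theorem apriori {k : ℂ} {Q : ℝ} (hab : a ≤ b) (hq : IntervalIntegrable q volume a b)
    (hQ : ∫ t in a..b, ‖q t‖ ≤ Q) (hk : 0 ≤ k.re) (hk0 : k ≠ 0) (hkQ : 2 * Q ≤ ‖k‖)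
    (h : SLSol q (-k ^ 2) a b y y') {x : ℝ} (hx : x ∈ Icc a b) :
    ‖y x‖ ≤ Real.exp (k.re * (x - a)) * ((‖y' a + k * y a‖ + ‖y' a - k * y a‖) / ‖k‖) ∧
    ‖y' x + k * y x - Complex.exp (k * (x - a)) * (y' a + k * y a)‖ ≤
      Real.exp (k.re * (x - a)) * (Q * ((‖y' a + k * y a‖ + ‖y' a - k * y a‖) / ‖k‖)) ∧
    ‖y' x - k * y x - Complex.exp (-(k * (x - a))) * (y' a - k * y a)‖ ≤
      Real.exp (k.re * (x - a)) * (Q * ((‖y' a + k * y a‖ + ‖y' a - k * y a‖) / ‖k‖)) := by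
  set A := ‖y' a + k * y a‖ + ‖y' a - k * y a‖ with hA
  have hkpos : 0 < ‖k‖ := norm_pos_iff.2 hk0
  have hQ0 : 0 ≤ Q := (intervalIntegral.integral_nonneg hab fun t _ => norm_nonneg (q t)).trans hQ
  have hqc : IntervalIntegrable (fun t => (q t : ℂ)) volume a b := ⟨hq.1.ofReal, hq.2.ofReal⟩
  have hQc : ∫ t in a..b, ‖(q t : ℂ)‖ ≤ Q := by simpa using hQ
  have hexp : ∀ (c : ℂ) (t : ℝ), HasDerivAt (fun t : ℝ => Complex.exp (c * (t - a)))
      (Complex.exp (c * (t - a)) * c) t := fun c t => by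
    have := (((Complex.ofRealCLM.hasDerivAt (x := t)).sub_const (a : ℂ)).const_mul c).cexp
    simpa using this
  have hcexp : ∀ c : ℂ, Continuous fun t : ℝ => Complex.exp (c * (t - a)) := fun c => by fun_prop
  have hEac : ∀ c : ℂ, AbsolutelyContinuousOnInterval
      (fun t : ℝ => Complex.exp (c * (t - a))) a b := fun c =>
    AbsolutelyContinuousOnInterval.of_hasDerivWithinAt hab
      (fun t _ => (hexp c t).hasDerivWithinAt) (by fun_prop)
  have hEn : ∀ (c : ℂ) (t : ℝ), ‖Complex.exp (c * (t - a))‖ = Real.exp (c.re * (t - a)) :=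
    fun c t => by
      rw [Complex.norm_exp]; congr 1
      rw [← Complex.ofReal_sub, Complex.re_mul_ofReal]
  have hyc := h.continuousOn
  have hW : ContinuousOn (fun t : ℝ => ‖Complex.exp (-k * (t - a)) * y t‖) (Icc a b) :=
    ((hcexp (-k)).continuousOn.mul hyc).norm
  -- N is the maximum of |y| after removal of the fastest possible growth. All errors are first
  -- expressed in N, which is then bounded by the data at a.
  obtain ⟨x₀, hx₀, hmax⟩ := isCompact_Icc.exists_isMaxOn (nonempty_Icc.2 hab) hW
  set N := ‖Complex.exp (-k * (x₀ - a)) * y x₀‖ with hN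
  have hN0 : 0 ≤ N := norm_nonneg _
  have hWN : ∀ t ∈ Icc a b, ‖y t‖ ≤ Real.exp (k.re * (t - a)) * N := fun t ht => by
    have h1 : ‖Complex.exp (-k * (t - a)) * y t‖ ≤ N := hmax ht
    rw [norm_mul, hEn, Complex.neg_re] at h1
    calc ‖y t‖ = Real.exp (k.re * (t - a)) * (Real.exp (-k.re * (t - a)) * ‖y t‖) := by
          rw [← mul_assoc, ← Real.exp_add]; simp
      _ ≤ _ := mul_le_mul_of_nonneg_left h1 (Real.exp_pos _).le
  have hU : ∀ t ∈ Icc a b, ‖y' t + k * y t - Complex.exp (k * (t - a)) * (y' a + k * y a)‖ ≤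
      Real.exp (k.re * (t - a)) * (Q * N) := by
    intro t ht
    have hac := (hEac (-k)).mul_complex (h.ac.fun_add
      ((AbsolutelyContinuousOnInterval.const k).mul_complex (h.ac_left hab)))
    have e := hac.integral_eq_sub_of_ae_hasDerivAt
      (g := fun t => (q t : ℂ) * (Complex.exp (-k * (t - a)) * y t))
      (hqc.mul_continuousOn_Icc hab ((hcexp (-k)).continuousOn.mul hyc)) (by
        filter_upwards [h.ae] with s h1 hs
        exact ((hexp (-k) s).mul ((h1 hs).add ((h.hasDerivAt hs).const_mul k))).congr_deriv (by
          simp only [Pi.add_apply]; ring)) ht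
    have hb := norm_integral_mul_le_of_bound (y := fun t => Complex.exp (-k * (t - a)) * y t)
      hqc hQc ht hN0 (fun s hs => hmax ⟨hs.1.le, hs.2.trans ht.2⟩)
    have e2 : y' t + k * y t - Complex.exp (k * (t - a)) * (y' a + k * y a) =
        Complex.exp (k * (t - a)) * ∫ t in a..t, (q t : ℂ) * (Complex.exp (-k * (t - a)) * y t) := by
      have e3 : Complex.exp (k * (t - a)) * Complex.exp (-k * (t - a)) = 1 := by
        rw [← Complex.exp_add]; simp
      simp only [sub_self, mul_zero, Complex.exp_zero, one_mul] at e
      linear_combination (-(y' t + k * y t)) * e3 + Complex.exp (k * (t - a)) * e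
    rw [e2, norm_mul, hEn]
    exact mul_le_mul_of_nonneg_left hb (Real.exp_pos _).le
  have hV : ∀ t ∈ Icc a b, ‖y' t - k * y t - Complex.exp (-(k * (t - a))) * (y' a - k * y a)‖ ≤
      Real.exp (k.re * (t - a)) * (Q * N) := by
    intro t ht
    have hac := (hEac k).mul_complex (h.ac.fun_sub
      ((AbsolutelyContinuousOnInterval.const k).mul_complex (h.ac_left hab)))
    have e := hac.integral_eq_sub_of_ae_hasDerivAt
      (g := fun t => (q t : ℂ) * (Complex.exp (k * (t - a)) * y t))
      (hqc.mul_continuousOn_Icc hab ((hcexp k).continuousOn.mul hyc)) (by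
        filter_upwards [h.ae] with s h1 hs
        exact ((hexp k s).mul ((h1 hs).sub ((h.hasDerivAt hs).const_mul k))).congr_deriv (by
          simp only [Pi.sub_apply]; ring)) ht
    have hb := norm_integral_mul_le_of_bound (y := fun t => Complex.exp (k * (t - a)) * y t)
      (B := Real.exp (k.re * (t - a)) * (Real.exp (k.re * (t - a)) * N))
      hqc hQc ht (by positivity) (fun s hs => by
        rw [norm_mul, hEn]
        have h1 := hWN s ⟨hs.1.le, hs.2.trans ht.2⟩
        have h2 : Real.exp (k.re * (s - a)) ≤ Real.exp (k.re * (t - a)) :=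
          Real.exp_le_exp.2 (mul_le_mul_of_nonneg_left (by linarith [hs.2]) hk)
        exact mul_le_mul h2 (h1.trans (mul_le_mul_of_nonneg_right h2 hN0)) (norm_nonneg _)
          (Real.exp_pos _).le)
    have e2 : y' t - k * y t - Complex.exp (-(k * (t - a))) * (y' a - k * y a) =
        Complex.exp (-k * (t - a)) * ∫ t in a..t, (q t : ℂ) * (Complex.exp (k * (t - a)) * y t) := by
      have e3 : Complex.exp (k * (t - a)) * Complex.exp (-k * (t - a)) = 1 := by
        rw [← Complex.exp_add]; simp
      simp only [sub_self, mul_zero, Complex.exp_zero, one_mul] at e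
      rw [← neg_mul]
      linear_combination (-(y' t - k * y t)) * e3 + Complex.exp (-k * (t - a)) * e
    rw [e2, norm_mul, hEn]
    refine (mul_le_mul_of_nonneg_left hb (Real.exp_pos _).le).trans_eq ?_
    have e4 : Real.exp ((-k).re * (t - a)) * Real.exp (k.re * (t - a)) = 1 := by
      rw [← Real.exp_add]; simp
    linear_combination (Q * Real.exp (k.re * (t - a)) * N) * e4
  -- At the maximum point 2|k|N ≤ A + 2QN, and 2Q ≤ |k| absorbs the last term.
  have hNA : N ≤ A / ‖k‖ := by
    set e := Real.exp (k.re * (x₀ - a)) with he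
    have he1 : 1 ≤ e := Real.one_le_exp (mul_nonneg hk (by linarith [hx₀.1]))
    have hepos : 0 < e := Real.exp_pos _
    have hyx : ‖y x₀‖ = e * N := by
      rw [hN, norm_mul, hEn, ← mul_assoc, he, ← Real.exp_add]; simp
    have h1 : ‖y' x₀ + k * y x₀‖ ≤ e * ‖y' a + k * y a‖ + e * (Q * N) := by
      have := norm_add_le (Complex.exp (k * (x₀ - a)) * (y' a + k * y a))
        (y' x₀ + k * y x₀ - Complex.exp (k * (x₀ - a)) * (y' a + k * y a))
      rw [add_sub_cancel, norm_mul, hEn] at this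
      linarith [hU x₀ hx₀]
    have h2 : ‖y' x₀ - k * y x₀‖ ≤ e * ‖y' a - k * y a‖ + e * (Q * N) := by
      have := norm_add_le (Complex.exp (-k * (x₀ - a)) * (y' a - k * y a))
        (y' x₀ - k * y x₀ - Complex.exp (-k * (x₀ - a)) * (y' a - k * y a))
      rw [add_sub_cancel, norm_mul, hEn] at this
      have h3 := hV x₀ hx₀
      rw [← neg_mul] at h3
      have h4 : Real.exp ((-k).re * (x₀ - a)) ≤ e :=
        (Real.exp_le_one_iff.2 (by
          rw [Complex.neg_re, neg_mul]
          linarith [mul_nonneg hk (sub_nonneg.2 hx₀.1)])).trans he1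
      linarith [mul_le_mul_of_nonneg_right h4 (norm_nonneg (y' a - k * y a))]
    have h3 : 2 * ‖k‖ * ‖y x₀‖ ≤ ‖y' x₀ + k * y x₀‖ + ‖y' x₀ - k * y x₀‖ := by
      have := norm_sub_le (y' x₀ + k * y x₀) (y' x₀ - k * y x₀)
      rw [show y' x₀ + k * y x₀ - (y' x₀ - k * y x₀) = 2 * k * y x₀ by ring, norm_mul, norm_mul,
        Complex.norm_ofNat] at this
      exact this
    rw [hyx] at h3
    rw [le_div_iff₀ hkpos]
    have h4 : e * (2 * ‖k‖ * N) ≤ e * (A + 2 * Q * N) := by rw [hA]; nlinarith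
    have h5 := le_of_mul_le_mul_left h4 hepos
    nlinarith [mul_le_mul_of_nonneg_right hkQ hN0]
  have hQN : Q * N ≤ Q * (A / ‖k‖) := mul_le_mul_of_nonneg_left hNA hQ0
  exact ⟨(hWN x hx).trans (mul_le_mul_of_nonneg_left hNA (Real.exp_pos _).le),
    (hU x hx).trans (mul_le_mul_of_nonneg_left hQN (Real.exp_pos _).le),
    (hV x hx).trans (mul_le_mul_of_nonneg_left hQN (Real.exp_pos _).le)⟩

end SLSol

/-! ### Existence of solutions and dependence on the spectral parameter -/

/-- The solution of `-y'' + q y = lam y` with `y a = c`, `y' a = c'`. -/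
noncomputable def slSol (q : ℝ → ℝ) (lam : ℂ) (a : ℝ) (c c' : ℂ) : ℝ → ℂ :=
  picardSol (fun t => (q t : ℂ) - lam) a (fun x => c + c' * (x - a))

/-- The derivative of `slSol`. -/
noncomputable def slSol' (q : ℝ → ℝ) (lam : ℂ) (a : ℝ) (c c' : ℂ) (x : ℝ) : ℂ :=
  c' + ∫ t in a..x, ((q t : ℂ) - lam) * slSol q lam a c c' t

section Existence

variable {q : ℝ → ℝ} {a b : ℝ}

theorem slSol_isSol (hab : a ≤ b) (hq : IntervalIntegrable q volume a b) (lam c c' : ℂ) :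
    SLSol q lam a b (slSol q lam a c c') (slSol' q lam a c c') := by
  have hr := SLSol.intervalIntegrable_potential hq lam
  have hf : ContinuousOn (fun x : ℝ => c + c' * ((x : ℂ) - a)) (Icc a b) := by fun_prop
  have hyc : ContinuousOn (slSol q lam a c c') (Icc a b) := picardSol_continuousOn hab hr hf
  have hg := hr.mul_continuousOn_Icc hab hyc
  have hI := continuousOn_primitive_Icc hab hg
  refine ⟨fun x hx => ?_, (AbsolutelyContinuousOnInterval.const c').fun_add
    (AbsolutelyContinuousOnInterval.intervalIntegral_complex hab hg), ?_⟩
  · have h1 : HasDerivWithinAt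
        (fun u => ∫ s in a..u, ∫ t in a..s, ((q t : ℂ) - lam) * slSol q lam a c c' t)
        (∫ t in a..x, ((q t : ℂ) - lam) * slSol q lam a c c' t) (Icc a b) x := by
      have : Fact (x ∈ Icc a b) := ⟨hx⟩
      refine intervalIntegral.integral_hasDerivWithinAt_right
        ((hI.intervalIntegrable_Icc' hab).mono_Icc (left_mem_Icc.2 hab) hx) ?_ (hI x hx)
      exact hI.stronglyMeasurableAtFilter_nhdsWithin measurableSet_Icc x
    have h2 : HasDerivWithinAt (fun u : ℝ => c + c' * ((u : ℂ) - a)) c' (Icc a b) x := by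
      have := (((Complex.ofRealCLM.hasDerivAt (x := x)).sub_const (a : ℂ)).const_mul c').const_add c
      simpa using this.hasDerivWithinAt
    refine (h2.add h1).congr (fun u hu => ?_) ?_
    · exact picardSol_eq hab hr hf hu
    · exact picardSol_eq hab hr hf hx
  · have h := hg.ae_hasDerivAt_integral
    filter_upwards [h] with x hx hm
    rw [uIcc_of_le hab] at hx
    exact (hx (Ioo_subset_Icc_self hm) a (left_mem_Icc.2 hab)).const_add c'

theorem slSol_left (hab : a ≤ b) (hq : IntervalIntegrable q volume a b) (lam c c' : ℂ) :
    slSol q lam a c c' a = c := by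
  have := picardSol_eq hab (SLSol.intervalIntegrable_potential hq lam)
    (f := fun x : ℝ => c + c' * ((x : ℂ) - a)) (by fun_prop) (left_mem_Icc.2 hab)
  simpa [slSol] using this

@[simp] theorem slSol'_left (lam c c' : ℂ) : slSol' q lam a c c' a = c' := by
  simp [slSol']

theorem exists_bound_initial {c c' : ℂ → ℂ} (hc : Continuous c) (hc' : Continuous c') (R : ℝ) :
    ∃ C : ℝ, ∀ z : ℂ, ‖z‖ ≤ R → ∀ t ∈ Icc a b, ‖c z + c' z * ((t : ℂ) - a)‖ ≤ C := by
  have hK : IsCompact (Metric.closedBall (0 : ℂ) R ×ˢ Icc a b) :=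
    (isCompact_closedBall _ _).prod isCompact_Icc
  obtain ⟨C, hC⟩ := hK.exists_bound_of_continuousOn
    (f := fun p : ℂ × ℝ => c p.1 + c' p.1 * ((p.2 : ℂ) - a)) (by fun_prop)
  exact ⟨C, fun z hz t ht => hC (z, t) ⟨by simpa using hz, ht⟩⟩

theorem exists_bound_potential (hq : IntervalIntegrable q volume a b) (R : ℝ) :
    ∃ g : ℝ → ℝ, IntervalIntegrable g volume a b ∧
      ∀ z : ℂ, ‖z‖ ≤ R → ∀ t, ‖(q t : ℂ) - z‖ ≤ g t :=
  ⟨fun t => ‖q t‖ + R, hq.norm.add intervalIntegrable_const, fun z hz t =>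
    (norm_sub_le _ _).trans (by simpa using hz)⟩

/-- The initial data may depend on the spectral parameter, since the right half starts from the
matched values at 0. -/
theorem slSol_differentiable (hq : IntervalIntegrable q volume a b) {c c' : ℂ → ℂ}
    (hc : Differentiable ℂ c) (hc' : Differentiable ℂ c') {x : ℝ} (hx : x ∈ Icc a b) :
    Differentiable ℂ fun z => slSol q z a (c z) (c' z) x :=
  picardSol_differentiable (r := fun z t => (q t : ℂ) - z)
    (f := fun z x => c z + c' z * ((x : ℂ) - a))
    (fun z => SLSol.intervalIntegrable_potential hq z) (fun t => by fun_prop)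
    (exists_bound_potential hq) (fun z => by fun_prop) (fun t => by fun_prop)
    (exists_bound_initial hc.continuous hc'.continuous) hx

theorem slSol'_differentiable (hq : IntervalIntegrable q volume a b) {c c' : ℂ → ℂ}
    (hc : Differentiable ℂ c) (hc' : Differentiable ℂ c') {x : ℝ} (hx : x ∈ Icc a b) :
    Differentiable ℂ fun z => slSol' q z a (c z) (c' z) x := by
  have hab : a ≤ b := hx.1.trans hx.2
  refine hc'.add (differentiable_intervalIntegral_of_locally_bounded hx.1 (fun z => ?_)
    (fun t ht => ?_) fun R => ?_)
  · exact (((SLSol.intervalIntegrable_potential hq z).mul_continuousOn_Icc hab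
      (slSol_isSol hab hq z _ _).continuousOn).mono_Icc
        (left_mem_Icc.2 hab) hx).1.aestronglyMeasurable
  · exact ((differentiable_const _).sub differentiable_id).mul
      (slSol_differentiable hq hc hc' ⟨ht.1.le, ht.2.trans hx.2⟩)
  · obtain ⟨g, hg, hgb⟩ := exists_bound_potential hq R
    obtain ⟨C, hC⟩ := exists_bound_initial (a := a) (b := b) hc.continuous hc'.continuous R
    refine ⟨fun t => g t * ∑' n : ℕ, C * (∫ t in a..b, g t) ^ n * ((b - a) ^ n / n.factorial),
      (hg.mono_Icc (left_mem_Icc.2 hab) hx).mul_const _, fun z hz t ht => ?_⟩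
    rw [norm_mul]
    refine mul_le_mul (hgb z hz t) ?_ (norm_nonneg _) ((norm_nonneg _).trans (hgb z hz t))
    exact picardSol_bound (SLSol.intervalIntegrable_potential hq z)
      (intervalIntegral.integral_mono_on hab (SLSol.intervalIntegrable_potential hq z).norm hg
        fun t _ => hgb z hz t) (hC z hz) t ⟨ht.1.le, ht.2.trans hx.2⟩

end Existence

/-! ### Solutions matched at zero and their estimates -/

/-- A solution on `[-S, 0]` and a solution on `[0, S]` that are matched at `0` by `M`. -/
structure TSol (S : ℝ) (M : Matrix (Fin 2) (Fin 2) ℝ) (q : ℝ → ℝ) (lam : ℂ)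
    (yl yl' yr yr' : ℝ → ℂ) : Prop where
  left : SLSol q lam (-S) 0 yl yl'
  right : SLSol q lam 0 S yr yr'
  match_val : yr 0 = M 0 0 * yl 0 + M 0 1 * yl' 0
  match_deriv : yr' 0 = M 1 0 * yl 0 + M 1 1 * yl' 0

/-- The matrix that matches the reflected solutions. -/
noncomputable def reflectedMatrix (M : Matrix (Fin 2) (Fin 2) ℝ) : Matrix (Fin 2) (Fin 2) ℝ :=
  !![M 1 1 / M.det, M 0 1 / M.det; M 1 0 / M.det, M 0 0 / M.det]

/-- The factor by which matching with `M` amplifies solutions at `lam = -k ^ 2`. -/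
noncomputable def transferGrowth (M : Matrix (Fin 2) (Fin 2) ℝ) (k : ℂ) : ℝ :=
  1 + |M 0 1| * ‖k‖

theorem one_le_transferGrowth (M : Matrix (Fin 2) (Fin 2) ℝ) (k : ℂ) :
    1 ≤ transferGrowth M k := by
  have : 0 ≤ |M 0 1| * ‖k‖ := by positivity
  simpa [transferGrowth] using this

/-- The norm of the coordinates of `(y, y')` that diagonalise `y'' = k ^ 2 y`. -/
noncomputable def diagNorm (k y y' : ℂ) : ℝ := ‖y' + k * y‖ + ‖y' - k * y‖

theorem diagNorm_nonneg (k y y' : ℂ) : 0 ≤ diagNorm k y y' := by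
  unfold diagNorm; positivity

theorem diagNorm_le (k y y' : ℂ) : diagNorm k y y' ≤ 2 * (‖y'‖ + ‖k‖ * ‖y‖) := by
  have h1 := norm_add_le y' (k * y)
  have h2 := norm_sub_le y' (k * y)
  rw [norm_mul] at h1 h2
  unfold diagNorm
  linarith

theorem norm_le_diagNorm (k y y' : ℂ) : 2 * ‖y'‖ ≤ diagNorm k y y' := by
  have := norm_add_le (y' + k * y) (y' - k * y)
  rw [show y' + k * y + (y' - k * y) = 2 * y' by ring, norm_mul, Complex.norm_ofNat] at this
  exact this

theorem norm_mul_le_diagNorm (k y y' : ℂ) : 2 * (‖k‖ * ‖y‖) ≤ diagNorm k y y' := by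
  have := norm_sub_le (y' + k * y) (y' - k * y)
  rw [show y' + k * y - (y' - k * y) = 2 * (k * y) by ring, norm_mul, Complex.norm_ofNat,
    norm_mul] at this
  exact this

theorem diagNorm_reflect (k y y' : ℂ) : diagNorm k y (-y') = diagNorm k y y' := by
  unfold diagNorm
  rw [← norm_neg (-y' + k * y), ← norm_neg (-y' - k * y), add_comm]
  congr 2 <;> ring

/-- The constant in the bound for matching by `M`. -/
noncomputable def matchConst (M : Matrix (Fin 2) (Fin 2) ℝ) : ℝ :=
  1 + |M 0 0| + |M 1 0| + |M 1 1|

theorem one_le_matchConst (M : Matrix (Fin 2) (Fin 2) ℝ) : 1 ≤ matchConst M := by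
  have : 0 ≤ |M 0 0| + |M 1 0| + |M 1 1| := by positivity
  unfold matchConst; linarith

/-- In `diagNorm` the value y carries weight |k| and y' weight 1. Only `M 0 1`, which sends y' into
y, therefore costs a power of k; the other entries cost a constant once |k| ≥ 1. -/
theorem diagNorm_match_le (M : Matrix (Fin 2) (Fin 2) ℝ) {k y y' : ℂ} (hk : 1 ≤ ‖k‖) :
    diagNorm k (M 0 0 * y + M 0 1 * y') (M 1 0 * y + M 1 1 * y') ≤
      matchConst M * transferGrowth M k * diagNorm k y y' := by
  refine (diagNorm_le _ _ _).trans ?_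
  have h1 := norm_le_diagNorm k y y'
  have h2 := norm_mul_le_diagNorm k y y'
  have h3 : ‖(M 0 0 : ℂ) * y + M 0 1 * y'‖ ≤ |M 0 0| * ‖y‖ + |M 0 1| * ‖y'‖ := by
    refine (norm_add_le _ _).trans_eq ?_
    simp
  have h4 : ‖(M 1 0 : ℂ) * y + M 1 1 * y'‖ ≤ |M 1 0| * ‖y‖ + |M 1 1| * ‖y'‖ := by
    refine (norm_add_le _ _).trans_eq ?_
    simp
  have h5 : ‖y‖ ≤ ‖k‖ * ‖y‖ := le_mul_of_one_le_left (norm_nonneg _) hk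
  set A := diagNorm k y y'
  have hA : 0 ≤ A := diagNorm_nonneg _ _ _
  have a1 : |M 1 0| * (2 * ‖y‖) ≤ |M 1 0| * A :=
    mul_le_mul_of_nonneg_left (by linarith) (abs_nonneg _)
  have a2 : |M 1 1| * (2 * ‖y'‖) ≤ |M 1 1| * A := mul_le_mul_of_nonneg_left h1 (abs_nonneg _)
  have a3 : |M 0 0| * (2 * (‖k‖ * ‖y‖)) ≤ |M 0 0| * A := mul_le_mul_of_nonneg_left h2 (abs_nonneg _)
  have a4 : |M 0 1| * ‖k‖ * (2 * ‖y'‖) ≤ |M 0 1| * ‖k‖ * A :=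
    mul_le_mul_of_nonneg_left h1 (by positivity)
  have a5 := mul_le_mul_of_nonneg_left h3 (norm_nonneg k)
  calc 2 * (‖(M 1 0 : ℂ) * y + M 1 1 * y'‖ + ‖k‖ * ‖(M 0 0 : ℂ) * y + M 0 1 * y'‖)
      ≤ (|M 1 0| + |M 1 1| + |M 0 0| + |M 0 1| * ‖k‖) * A := by nlinarith
    _ ≤ _ := by
      refine mul_le_mul_of_nonneg_right ?_ hA
      unfold matchConst transferGrowth
      have : 0 ≤ (|M 0 0| + |M 1 0| + |M 1 1|) * (|M 0 1| * ‖k‖) := by positivity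
      nlinarith

/-- One unit of the factor 2 comes from the free exponentials, the other from the two errors, whose
sum is at most one unit because 2Q ≤ |k|. -/
theorem SLSol.diagNorm_right_le {q : ℝ → ℝ} {a b : ℝ} {y y' : ℝ → ℂ} {k : ℂ} {Q : ℝ} (hab : a ≤ b)
    (hq : IntervalIntegrable q volume a b) (hQ : ∫ t in a..b, ‖q t‖ ≤ Q) (hk : 0 ≤ k.re)
    (hk0 : k ≠ 0) (hkQ : 2 * Q ≤ ‖k‖) (h : SLSol q (-k ^ 2) a b y y') :
    diagNorm k (y b) (y' b) ≤ 2 * Real.exp (k.re * (b - a)) * diagNorm k (y a) (y' a) := by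
  obtain ⟨-, h2, h3⟩ := h.apriori hab hq hQ hk hk0 hkQ (right_mem_Icc.2 hab)
  have hkpos : 0 < ‖k‖ := norm_pos_iff.2 hk0
  have hre : (k * ((b : ℂ) - a)).re = k.re * (b - a) := by
    rw [← Complex.ofReal_sub, Complex.re_mul_ofReal]
  have h0 : 0 ≤ k.re * (b - a) := mul_nonneg hk (sub_nonneg.2 hab)
  have e1 := norm_sub_norm_le (y' b + k * y b) (Complex.exp (k * (b - a)) * (y' a + k * y a))
  have e2 := norm_sub_norm_le (y' b - k * y b) (Complex.exp (-(k * (b - a))) * (y' a - k * y a))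
  rw [norm_mul, Complex.norm_exp, hre] at e1
  rw [norm_mul, Complex.norm_exp, Complex.neg_re, hre] at e2
  have e3 : Real.exp (-(k.re * (b - a))) * ‖y' a - k * y a‖ ≤
      Real.exp (k.re * (b - a)) * ‖y' a - k * y a‖ :=
    mul_le_mul_of_nonneg_right (Real.exp_le_exp.2 (by linarith)) (norm_nonneg _)
  have hA := diagNorm_nonneg k (y a) (y' a)
  have e4 : 2 * (Q * (diagNorm k (y a) (y' a) / ‖k‖)) ≤ diagNorm k (y a) (y' a) := by
    rw [← mul_div_assoc, ← mul_div_assoc, div_le_iff₀ hkpos]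
    nlinarith
  have e5 := mul_le_mul_of_nonneg_left e4 (Real.exp_pos (k.re * (b - a))).le
  have e6 : Real.exp (k.re * (b - a)) * diagNorm k (y a) (y' a) =
    Real.exp (k.re * (b - a)) * ‖y' a + k * y a‖ +
      Real.exp (k.re * (b - a)) * ‖y' a - k * y a‖ := by unfold diagNorm; ring
  change ‖_‖ ≤ Real.exp (k.re * (b - a)) * (Q * (diagNorm k (y a) (y' a) / ‖k‖)) at h2 h3
  have e7 : diagNorm k (y b) (y' b) = ‖y' b + k * y b‖ + ‖y' b - k * y b‖ := rfl
  linarith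

namespace TSol

variable {S : ℝ} {M : Matrix (Fin 2) (Fin 2) ℝ} {q : ℝ → ℝ} {lam : ℂ}
  {yl yl' yr yr' zl zl' zr zr' : ℝ → ℂ}

theorem add (hy : TSol S M q lam yl yl' yr yr') (hz : TSol S M q lam zl zl' zr zr') :
    TSol S M q lam (fun x => yl x + zl x) (fun x => yl' x + zl' x) (fun x => yr x + zr x)
      (fun x => yr' x + zr' x) where
  left := hy.left.add hz.left
  right := hy.right.add hz.right
  match_val := by rw [hy.match_val, hz.match_val]; ring
  match_deriv := by rw [hy.match_deriv, hz.match_deriv]; ring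

theorem const_mul (c : ℂ) (hy : TSol S M q lam yl yl' yr yr') :
    TSol S M q lam (fun x => c * yl x) (fun x => c * yl' x) (fun x => c * yr x)
      (fun x => c * yr' x) where
  left := hy.left.const_mul c
  right := hy.right.const_mul c
  match_val := by rw [hy.match_val]; ring
  match_deriv := by rw [hy.match_deriv]; ring

/-- The Wronskian is constant on each half and is multiplied by det M at 0. -/
theorem wronskian_right (hS : 0 ≤ S) (hy : TSol S M q lam yl yl' yr yr')
    (hz : TSol S M q lam zl zl' zr zr') {x : ℝ} (hx : x ∈ Icc 0 S) :
    yr x * zr' x - yr' x * zr x = M.det * (yl (-S) * zl' (-S) - yl' (-S) * zl (-S)) := by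
  rw [hy.right.wronskian_eq hS hz.right hx,
    ← hy.left.wronskian_eq (by linarith) hz.left (x := 0) ⟨by linarith, le_rfl⟩,
    hy.match_val, hy.match_deriv, hz.match_val, hz.match_deriv, Matrix.det_fin_two]
  push_cast
  ring

/-- Reflection exchanges the halves and changes the sign of derivatives, so the new matching matrix
is D M⁻¹ D with D = diag(1, -1). -/
theorem reflect (hS : 0 ≤ S) (hM : M.det ≠ 0) (hql : IntervalIntegrable q volume (-S) 0)
    (hqr : IntervalIntegrable q volume 0 S) (h : TSol S M q lam yl yl' yr yr') :
    TSol S (reflectedMatrix M) (fun x => q (-x)) lam (fun x => yr (-x)) (fun x => -yr' (-x))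
      (fun x => yl (-x)) (fun x => -yl' (-x)) where
  left := by simpa using h.right.reflect hS hqr
  right := by simpa using h.left.reflect (by linarith) hql
  match_val := by
    have hdet : (M.det : ℂ) ≠ 0 := by exact_mod_cast hM
    simp only [neg_zero, h.match_val, h.match_deriv, reflectedMatrix]
    simp only [Matrix.of_apply, Matrix.cons_val', Matrix.cons_val_zero, Matrix.cons_val_one,
      Matrix.cons_val_fin_one, Complex.ofReal_div]
    field_simp
    rw [Matrix.det_fin_two]
    push_cast
    ring
  match_deriv := by
    have hdet : (M.det : ℂ) ≠ 0 := by exact_mod_cast hM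
    simp only [neg_zero, h.match_val, h.match_deriv, reflectedMatrix]
    simp only [Matrix.of_apply, Matrix.cons_val', Matrix.cons_val_zero, Matrix.cons_val_one,
      Matrix.cons_val_fin_one, Complex.ofReal_div]
    field_simp
    rw [Matrix.det_fin_two]
    push_cast
    ring

theorem forward_bound {k : ℂ} {Q : ℝ} (hS : 0 ≤ S) (hql : IntervalIntegrable q volume (-S) 0)
    (hqr : IntervalIntegrable q volume 0 S) (hQl : ∫ t in (-S)..0, ‖q t‖ ≤ Q)
    (hQr : ∫ t in (0 : ℝ)..S, ‖q t‖ ≤ Q) (hk : 0 ≤ k.re) (hk1 : 1 ≤ ‖k‖) (hkQ : 2 * Q ≤ ‖k‖)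
    (h : TSol S M q (-k ^ 2) yl yl' yr yr') :
    (∀ x ∈ Icc (-S) 0, ‖yl x‖ ≤
      Real.exp (k.re * (x + S)) * (diagNorm k (yl (-S)) (yl' (-S)) / ‖k‖)) ∧
    (∀ x ∈ Icc 0 S, ‖yr x‖ ≤ 2 * matchConst M * transferGrowth M k *
      (Real.exp (k.re * (x + S)) * (diagNorm k (yl (-S)) (yl' (-S)) / ‖k‖))) := by
  have hk0 : k ≠ 0 := norm_pos_iff.1 (by linarith)
  have hS' : -S ≤ 0 := by linarith
  refine ⟨fun x hx => ?_, fun x hx => ?_⟩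
  · have := (h.left.apriori hS' hql hQl hk hk0 hkQ hx).1
    rwa [sub_neg_eq_add] at this
  · have h1 := (h.right.apriori hS hqr hQr hk hk0 hkQ hx).1
    change ‖yr x‖ ≤ _ * (diagNorm k (yr 0) (yr' 0) / ‖k‖) at h1
    have h2 := h.left.diagNorm_right_le hS' hql hQl hk hk0 hkQ
    have h3 := diagNorm_match_le M (y := yl 0) (y' := yl' 0) hk1
    rw [← h.match_val, ← h.match_deriv] at h3
    rw [zero_sub, neg_neg] at h2
    rw [sub_zero] at h1
    have hc : 0 ≤ matchConst M * transferGrowth M k :=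
      mul_nonneg (zero_le_one.trans (one_le_matchConst M))
        (zero_le_one.trans (one_le_transferGrowth M k))
    have h4 := h3.trans (mul_le_mul_of_nonneg_left h2 hc)
    refine h1.trans ((mul_le_mul_of_nonneg_left (div_le_div_of_nonneg_right h4 (norm_nonneg k))
      (Real.exp_pos _).le).trans_eq ?_)
    rw [mul_add k.re, Real.exp_add]
    ring

/-- This is `forward_bound` for the reflected solution, whose data at -S are those of the original
at S. -/
theorem backward_bound {k : ℂ} {Q : ℝ} (hS : 0 ≤ S) (hM : 0 < M.det)
    (hql : IntervalIntegrable q volume (-S) 0)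
    (hqr : IntervalIntegrable q volume 0 S) (hQl : ∫ t in (-S)..0, ‖q t‖ ≤ Q)
    (hQr : ∫ t in (0 : ℝ)..S, ‖q t‖ ≤ Q) (hk : 0 ≤ k.re) (hk1 : 1 ≤ ‖k‖) (hkQ : 2 * Q ≤ ‖k‖)
    (h : TSol S M q (-k ^ 2) yl yl' yr yr') :
    (∀ x ∈ Icc 0 S, ‖yr x‖ ≤
      Real.exp (k.re * (S - x)) * (diagNorm k (yr S) (yr' S) / ‖k‖)) ∧
    (∀ x ∈ Icc (-S) 0, ‖yl x‖ ≤
      2 * matchConst (reflectedMatrix M) * ((1 + 1 / M.det) * transferGrowth M k) *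
      (Real.exp (k.re * (S - x)) * (diagNorm k (yr S) (yr' S) / ‖k‖))) := by
  have hr := h.reflect hS hM.ne' hql hqr
  have hql' : IntervalIntegrable (fun x => q (-x)) volume (-S) 0 := by
    have h1 := IntervalIntegrable.comp_sub_left hqr 0
    simpa using h1.symm
  have hqr' : IntervalIntegrable (fun x => q (-x)) volume 0 S := by
    have h1 := IntervalIntegrable.comp_sub_left hql 0
    simpa using h1.symm
  have e1 : ∫ t in (-S)..0, ‖q (-t)‖ ≤ Q := by
    have := intervalIntegral.integral_comp_neg (a := -S) (b := 0) (fun t => ‖q t‖)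
    rw [this]; simpa using hQr
  have e2 : ∫ t in (0 : ℝ)..S, ‖q (-t)‖ ≤ Q := by
    have := intervalIntegral.integral_comp_neg (a := 0) (b := S) (fun t => ‖q t‖)
    rw [this]; simpa using hQl
  obtain ⟨b1, b2⟩ := hr.forward_bound hS hql' hqr' e1 e2 hk hk1 hkQ
  simp only [neg_neg, diagNorm_reflect] at b1 b2
  refine ⟨fun x hx => ?_, fun x hx => ?_⟩
  · have := b1 (-x) ⟨by linarith [hx.2], by linarith [hx.1]⟩
    rwa [neg_neg, neg_add_eq_sub] at this
  · have := b2 (-x) ⟨by linarith [hx.2], by linarith [hx.1]⟩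
    rw [neg_neg, neg_add_eq_sub] at this
    refine this.trans (mul_le_mul_of_nonneg_right (mul_le_mul_of_nonneg_left ?_ ?_) ?_)
    -- The reflected matrix has upper right entry `M 0 1 / M.det`, so its growth factor is at most 1
    -- + 1/det M times that of M.
    · have hd : 0 < 1 / M.det := by positivity
      simp only [transferGrowth, reflectedMatrix, Matrix.of_apply, Matrix.cons_val',
        Matrix.cons_val_zero, Matrix.cons_val_one, Matrix.cons_val_fin_one]
      rw [abs_div, abs_of_pos hM, div_mul_eq_mul_div, div_eq_mul_one_div]
      have : 0 ≤ |M 0 1| * ‖k‖ := by positivity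
      nlinarith
    · linarith [one_le_matchConst (reflectedMatrix M)]
    · exact mul_nonneg (Real.exp_pos _).le (div_nonneg (diagNorm_nonneg _ _ _) (norm_nonneg _))

end TSol

/-! ### Asymptotics as `Re k → ∞` -/

/-- The filter `comap Complex.re atTop` means Re k → ∞ with Im k arbitrary. This uniformity matters
later, when |Im k| grows as fast as Re k. -/
theorem tendsto_norm_comap_re : Tendsto (fun k : ℂ => ‖k‖) (comap Complex.re atTop) atTop :=
  tendsto_atTop_mono (fun k => (le_abs_self _).trans (Complex.abs_re_le_norm k)) tendsto_comap

theorem tendsto_inv_comap_re : Tendsto (fun k : ℂ => k⁻¹) (comap Complex.re atTop) (𝓝 0) := by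
  rw [tendsto_zero_iff_norm_tendsto_zero]
  simp_rw [norm_inv]
  exact tendsto_norm_comap_re.inv_tendsto_atTop

theorem tendsto_exp_neg_comap_re {c : ℝ} (hc : 0 < c) :
    Tendsto (fun k : ℂ => Complex.exp (-(k * c))) (comap Complex.re atTop) (𝓝 0) := by
  rw [tendsto_zero_iff_norm_tendsto_zero]
  have h1 : Tendsto (fun k : ℂ => k.re * c) (comap Complex.re atTop) atTop :=
    tendsto_comap.atTop_mul_const hc
  have h2 := Real.tendsto_exp_neg_atTop_nhds_zero.comp h1
  refine h2.congr fun k => ?_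
  simp [Complex.norm_exp]

/-- To leading order the growing coordinate y' + k y is multiplied by e^{k(b-a)} while the other
becomes negligible; the relative error is O(1/|k|) by `apriori`. The free normalisation ε lets the
statement be applied on both sides of 0. -/
theorem SLSol.tendsto_diag {q : ℝ → ℝ} {a b : ℝ} {y y' : ℂ → ℝ → ℂ} {ε : ℂ → ℂ} {α β : ℂ}
    (hab : a < b) (hq : IntervalIntegrable q volume a b)
    (h : ∀ k, SLSol q (-k ^ 2) a b (y k) (y' k))
    (hα : Tendsto (fun k => ε k * (y' k a + k * y k a)) (comap Complex.re atTop) (𝓝 α))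
    (hβ : Tendsto (fun k => ε k * (y' k a - k * y k a)) (comap Complex.re atTop) (𝓝 β)) :
    Tendsto (fun k => ε k * Complex.exp (-(k * (b - a))) * (y' k b + k * y k b))
      (comap Complex.re atTop) (𝓝 α) ∧
    Tendsto (fun k => ε k * Complex.exp (-(k * (b - a))) * (y' k b - k * y k b))
      (comap Complex.re atTop) (𝓝 0) := by
  set Q := ∫ t in a..b, ‖q t‖ with hQ
  have hlarge : ∀ᶠ k : ℂ in comap Complex.re atTop, 0 ≤ k.re ∧ k ≠ 0 ∧ 2 * Q ≤ ‖k‖ := by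
    filter_upwards [tendsto_comap.eventually_ge_atTop (0 : ℝ),
      tendsto_norm_comap_re.eventually_gt_atTop 0,
      tendsto_norm_comap_re.eventually_ge_atTop (2 * Q)] with k h1 h2 h3
    exact ⟨h1, norm_pos_iff.1 h2, h3⟩
  have hre : ∀ k : ℂ, (k * ((b : ℂ) - a)).re = k.re * (b - a) := fun k => by
    rw [← Complex.ofReal_sub, Complex.re_mul_ofReal]
  have hexp : ∀ k : ℂ, Complex.exp (-(k * (b - a))) * Complex.exp (k * (b - a)) = 1 := fun k => by
    rw [← Complex.exp_add]; simp
  have hexpn : ∀ k : ℂ, ‖Complex.exp (-(k * (b - a)))‖ * Real.exp (k.re * (b - a)) = 1 := fun k => by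
    rw [Complex.norm_exp, Complex.neg_re, hre, ← Real.exp_add]; simp
  have hE : Tendsto (fun k : ℂ => Q * ((‖ε k * (y' k a + k * y k a)‖ +
      ‖ε k * (y' k a - k * y k a)‖) * ‖k‖⁻¹)) (comap Complex.re atTop) (𝓝 0) := by
    have := ((hα.norm.add hβ.norm).mul tendsto_norm_comap_re.inv_tendsto_atTop).const_mul Q
    simpa using this
  constructor
  · have hz : Tendsto (fun k => ε k * Complex.exp (-(k * (b - a))) * (y' k b + k * y k b) -
        ε k * (y' k a + k * y k a)) (comap Complex.re atTop) (𝓝 0) := by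
      refine squeeze_zero_norm' ?_ hE
      filter_upwards [hlarge] with k ⟨h1, h2, h3⟩
      have := ((h k).apriori hab.le hq hQ.symm.le h1 h2 h3 (right_mem_Icc.2 hab.le)).2.1
      have e : ε k * Complex.exp (-(k * (b - a))) * (y' k b + k * y k b) -
          ε k * (y' k a + k * y k a) = ε k * (Complex.exp (-(k * (b - a))) *
          (y' k b + k * y k b - Complex.exp (k * (b - a)) * (y' k a + k * y k a))) := by
        linear_combination (ε k * (y' k a + k * y k a)) * hexp k
      rw [e, norm_mul, norm_mul, norm_mul, norm_mul]
      have h5 := mul_le_mul_of_nonneg_left (mul_le_mul_of_nonneg_left this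
        (norm_nonneg (Complex.exp (-(k * (b - a)))))) (norm_nonneg (ε k))
      refine h5.trans_eq ?_
      rw [← mul_assoc ‖Complex.exp _‖, hexpn, one_mul, div_eq_mul_inv]
      ring
    simpa using hz.add hα
  · have hz : Tendsto (fun k => ε k * Complex.exp (-(k * (b - a))) * (y' k b - k * y k b) -
        Complex.exp (-(k * (b - a))) * Complex.exp (-(k * (b - a))) *
          (ε k * (y' k a - k * y k a))) (comap Complex.re atTop) (𝓝 0) := by
      refine squeeze_zero_norm' ?_ hE
      filter_upwards [hlarge] with k ⟨h1, h2, h3⟩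
      have := ((h k).apriori hab.le hq hQ.symm.le h1 h2 h3 (right_mem_Icc.2 hab.le)).2.2
      have e : ε k * Complex.exp (-(k * (b - a))) * (y' k b - k * y k b) -
          Complex.exp (-(k * (b - a))) * Complex.exp (-(k * (b - a))) *
          (ε k * (y' k a - k * y k a)) = ε k * (Complex.exp (-(k * (b - a))) *
          (y' k b - k * y k b - Complex.exp (-(k * (b - a))) * (y' k a - k * y k a))) := by
        ring
      rw [e, norm_mul, norm_mul, norm_mul, norm_mul]
      have h5 := mul_le_mul_of_nonneg_left (mul_le_mul_of_nonneg_left this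
        (norm_nonneg (Complex.exp (-(k * (b - a)))))) (norm_nonneg (ε k))
      refine h5.trans_eq ?_
      rw [← mul_assoc ‖Complex.exp _‖, hexpn, one_mul, div_eq_mul_inv]
      ring
    have h0 := tendsto_exp_neg_comap_re (sub_pos.2 hab)
    push_cast at h0
    simpa using hz.add ((h0.mul h0).mul hβ)

/-- The solution that vanishes at `-S` with derivative `1` is large at `S` when `Re k` is large. -/
theorem TSol.eventually_le_norm_right {S : ℝ} {M : Matrix (Fin 2) (Fin 2) ℝ} {q : ℝ → ℝ}
    {yl yl' yr yr' : ℂ → ℝ → ℂ} (hS : 0 < S) (hM : 0 < M.det)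
    (hql : IntervalIntegrable q volume (-S) 0) (hqr : IntervalIntegrable q volume 0 S)
    (h : ∀ k, TSol S M q (-k ^ 2) (yl k) (yl' k) (yr k) (yr' k))
    (h0 : ∀ k, yl k (-S) = 0) (h1 : ∀ k, yl' k (-S) = 1) :
    ∃ c > 0, ∀ᶠ k : ℂ in comap Complex.re atTop,
      c * (Real.exp (k.re * (2 * S)) * transferGrowth M k / ‖k‖) ≤ ‖yr k S‖ := by
  obtain ⟨hU, hV⟩ := SLSol.tendsto_diag (ε := fun _ => 1) (α := 1) (β := 1) (by linarith : -S < 0)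
    hql (fun k => (h k).left) (by simp [h0, h1, tendsto_const_nhds])
    (by simp [h0, h1, tendsto_const_nhds])
  simp only [one_mul, Complex.ofReal_zero, Complex.ofReal_neg, zero_sub, neg_neg] at hU hV
  set U : ℂ → ℂ := fun k => Complex.exp (-(k * S)) * (yl' k 0 + k * yl k 0) with hUdef
  set V : ℂ → ℂ := fun k => Complex.exp (-(k * S)) * (yl' k 0 - k * yl k 0) with hVdef
  have hk0 : ∀ᶠ k : ℂ in comap Complex.re atTop, k ≠ 0 := by
    filter_upwards [tendsto_norm_comap_re.eventually_gt_atTop 0] with k h2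
    exact norm_pos_iff.1 h2
  have hplus : ∀ k : ℂ, k ≠ 0 → Complex.exp (-(k * S)) * yr' k 0 =
      M 1 0 * ((U k - V k) / 2) * k⁻¹ + M 1 1 * ((U k + V k) / 2) := fun k hk => by
    simp only [hUdef, hVdef, (h k).match_deriv]; field_simp; ring
  have hplus' : ∀ k : ℂ, k ≠ 0 → Complex.exp (-(k * S)) * (k * yr k 0) =
      M 0 0 * ((U k - V k) / 2) + M 0 1 * ((U k + V k) / 2) * k := fun k hk => by
    simp only [hUdef, hVdef, (h k).match_val]; field_simp; ring
  have hdiff : Tendsto (fun k => (U k - V k) / 2) (comap Complex.re atTop) (𝓝 (1 / 2)) := by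
    simpa using (hU.sub hV).div_const 2
  have hsum : Tendsto (fun k => (U k + V k) / 2) (comap Complex.re atTop) (𝓝 (1 / 2)) := by
    simpa using (hU.add hV).div_const 2
  have hA := ((hdiff.const_mul (M 1 0 : ℂ)).mul tendsto_inv_comap_re).add
    (hsum.const_mul (M 1 1 : ℂ))
  -- The scale d(k) is the order of growth caused by matching: 1 if `M 0 1` = 0, and k otherwise.
  obtain ⟨d, C, hC, hdC, α, β, hα0, hα, hβ⟩ : ∃ (d : ℂ → ℂ) (C : ℝ), 0 < C ∧
      (∀ᶠ k : ℂ in comap Complex.re atTop, d k ≠ 0 ∧ transferGrowth M k ≤ C * ‖d k‖) ∧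
      ∃ α β : ℂ, α ≠ 0 ∧
      Tendsto (fun k => (d k)⁻¹ * Complex.exp (-(k * S)) * (yr' k 0 + k * yr k 0))
        (comap Complex.re atTop) (𝓝 α) ∧
      Tendsto (fun k => (d k)⁻¹ * Complex.exp (-(k * S)) * (yr' k 0 - k * yr k 0))
        (comap Complex.re atTop) (𝓝 β) := by
    by_cases hm : M 0 1 = 0
    · refine ⟨fun _ => 1, 1, one_pos, Eventually.of_forall fun k => by simp [transferGrowth, hm],
        M 1 1 * (1 / 2) + M 0 0 * (1 / 2), M 1 1 * (1 / 2) - M 0 0 * (1 / 2), ?_, ?_, ?_⟩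
      -- With `M 0 1` = 0 the leading coefficient is (m₀₀ + m₁₁)/2. It is nonzero because det M =
      -- m₀₀ m₁₁ > 0 excludes opposite diagonal entries.
      · rw [Matrix.det_fin_two, hm, zero_mul, sub_zero] at hM
        have : M 1 1 + M 0 0 ≠ 0 := fun h => by
          have : M 1 1 = -M 0 0 := by linarith
          rw [this] at hM
          nlinarith [sq_nonneg (M 0 0)]
        rw [← add_mul]
        refine mul_ne_zero (by exact_mod_cast this) (by norm_num)
      · have := hA.add (hdiff.const_mul (M 0 0 : ℂ))
        simp only [mul_zero, zero_add] at this
        refine this.congr' ?_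
        filter_upwards [hk0] with k hk
        rw [inv_one, one_mul, mul_add, hplus k hk, hplus' k hk, hm]
        push_cast; ring
      · have := hA.sub (hdiff.const_mul (M 0 0 : ℂ))
        simp only [mul_zero, zero_add] at this
        refine this.congr' ?_
        filter_upwards [hk0] with k hk
        rw [inv_one, one_mul, mul_sub, hplus k hk, hplus' k hk, hm]
        push_cast; ring
    · refine ⟨fun k => k, 1 + |M 0 1|, by positivity, ?_,
        M 0 1 * (1 / 2), -(M 0 1 * (1 / 2)), ?_, ?_, ?_⟩
      · filter_upwards [hk0, tendsto_norm_comap_re.eventually_ge_atTop 1] with k hk hk1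
        refine ⟨hk, ?_⟩
        unfold transferGrowth; linarith
      · exact mul_ne_zero (by exact_mod_cast hm) (by norm_num)
      · have := (tendsto_inv_comap_re.mul (hA.add (hdiff.const_mul (M 0 0 : ℂ)))).add
          (hsum.const_mul (M 0 1 : ℂ))
        simp only [zero_mul, zero_add] at this
        refine this.congr' ?_
        filter_upwards [hk0] with k hk
        linear_combination (-k⁻¹) * hplus k hk - k⁻¹ * hplus' k hk -
          (M 0 1 * ((U k + V k) / 2)) * inv_mul_cancel₀ hk
      · have := (tendsto_inv_comap_re.mul (hA.sub (hdiff.const_mul (M 0 0 : ℂ)))).sub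
          (hsum.const_mul (M 0 1 : ℂ))
        simp only [zero_mul, zero_sub] at this
        refine this.congr' ?_
        filter_upwards [hk0] with k hk
        linear_combination (-k⁻¹) * hplus k hk + k⁻¹ * hplus' k hk +
          (M 0 1 * ((U k + V k) / 2)) * inv_mul_cancel₀ hk
  obtain ⟨hU2, hV2⟩ := SLSol.tendsto_diag (ε := fun k => (d k)⁻¹ * Complex.exp (-(k * S))) hS hqr
    (fun k => (h k).right) hα hβ
  have hlim := (hU2.sub hV2).norm
  rw [sub_zero] at hlim
  have hαpos : 0 < ‖α‖ := norm_pos_iff.2 hα0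
  have hev := hlim.eventually (eventually_ge_nhds (half_lt_self hαpos))
  -- Half of |α| is kept from the limit, another half goes into 2 k y = (y' + k y) - (y' - k y), and
  -- C compares d with `transferGrowth`.
  refine ⟨‖α‖ / 4 / C, by positivity, ?_⟩
  filter_upwards [hev, hdC, hk0] with k hk1 ⟨hk2, hk3⟩ hk4
  have hkpos : 0 < ‖k‖ := norm_pos_iff.2 hk4
  have hdpos : 0 < ‖d k‖ := norm_pos_iff.2 hk2
  have e1 : (d k)⁻¹ * Complex.exp (-(k * S)) * Complex.exp (-(k * (S - (0 : ℝ)))) *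
      (yr' k S + k * yr k S) - (d k)⁻¹ * Complex.exp (-(k * S)) *
      Complex.exp (-(k * (S - (0 : ℝ)))) * (yr' k S - k * yr k S) =
      (d k)⁻¹ * Complex.exp (-(k * (2 * S))) * (2 * k * yr k S) := by
    have : Complex.exp (-(k * (2 * S))) = Complex.exp (-(k * S)) *
        Complex.exp (-(k * (S - (0 : ℝ)))) := by
      rw [← Complex.exp_add]; congr 1; push_cast; ring
    rw [this]; ring
  rw [e1] at hk1
  have e2 : ‖Complex.exp (-(k * (2 * S)))‖ = (Real.exp (k.re * (2 * S)))⁻¹ := by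
    rw [Complex.norm_exp, ← Real.exp_neg, Complex.neg_re]
    congr 2
    have : (2 * S : ℂ) = ((2 * S : ℝ) : ℂ) := by push_cast; ring
    rw [this, Complex.re_mul_ofReal]
  rw [norm_mul, norm_mul, norm_mul, norm_mul, norm_inv, e2, Complex.norm_ofNat] at hk1
  set E := Real.exp (k.re * (2 * S)) with hE
  have hEpos : 0 < E := Real.exp_pos _
  have h5 : ‖α‖ / 4 * (E * ‖d k‖ / ‖k‖) ≤ ‖yr k S‖ := by
    have h6 : ‖α‖ / 2 * (E * ‖d k‖) ≤ 2 * ‖k‖ * ‖yr k S‖ := by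
      have := mul_le_mul_of_nonneg_right hk1 (mul_pos hEpos hdpos).le
      refine this.trans_eq ?_
      field_simp
    rw [← mul_div_assoc, div_le_iff₀ hkpos]
    linarith
  refine le_trans ?_ h5
  calc ‖α‖ / 4 / C * (E * transferGrowth M k / ‖k‖)
      ≤ ‖α‖ / 4 / C * (E * (C * ‖d k‖) / ‖k‖) := by gcongr
    _ = _ := by field_simp

/-! ### A Phragmén-Lindelöf argument -/

theorem exists_sq_eq_neg (z : ℂ) : ∃ k : ℂ, -k ^ 2 = z ∧ 0 ≤ k.re := by
  obtain ⟨k, hk⟩ := IsAlgClosed.exists_pow_nat_eq (-z) (n := 2) (by norm_num)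
  rcases le_total 0 k.re with h | h
  · exact ⟨k, by rw [hk, neg_neg], h⟩
  · exact ⟨-k, by rw [neg_sq, hk, neg_neg], by simpa using h⟩

theorem exists_sq_eq_quadrant {z : ℂ} (hz : 0 ≤ z.im) : ∃ w : ℂ, w ^ 2 = z ∧ 0 ≤ w.re ∧ 0 ≤ w.im := by
  obtain ⟨w, hw⟩ := IsAlgClosed.exists_pow_nat_eq z (n := 2) (by norm_num)
  have him : z.im = 2 * (w.re * w.im) := by rw [← hw, sq, Complex.mul_im]; ring
  rw [him] at hz
  rcases mul_nonneg_iff.1 (by linarith : 0 ≤ w.re * w.im) with ⟨h1, h2⟩ | ⟨h1, h2⟩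
  · exact ⟨w, hw, h1, h2⟩
  · exact ⟨-w, by rw [neg_sq, hw], by simpa using h1, by simpa using h2⟩

/-- The map w ↦ c w² with c = ±i sends the first quadrant onto the left or right half-plane and its
two edges into the imaginary axis. The composite grows like exp(C|w|), of order 1 < 2, which
Phragmén-Lindelöf in a quadrant permits. -/
theorem bounded_of_bounded_on_rays {F : ℂ → ℂ} (hF : Differentiable ℂ F) {C K B : ℝ}
    (hgrow : ∀ k : ℂ, 0 ≤ k.re → K ≤ ‖k‖ → ‖F (-k ^ 2)‖ ≤ C * Real.exp (C * ‖k‖))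
    (haxis : ∀ t : ℝ, ‖F (t * Complex.I)‖ ≤ B) (z : ℂ) : ‖F z‖ ≤ B := by
  have key : ∀ c : ℂ, c = Complex.I ∨ c = -Complex.I → ∀ w : ℂ, 0 ≤ w.re → 0 ≤ w.im →
      ‖F (c * w ^ 2)‖ ≤ B := by
    intro c hc w hw1 hw2
    have hcn : ‖c‖ = 1 := by rcases hc with rfl | rfl <;> simp
    have haxis' : ∀ t : ℝ, ‖F (c * t)‖ ≤ B := fun t => by
      rcases hc with rfl | rfl
      · rw [mul_comm]; exact haxis t
      · have := haxis (-t)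
        rwa [show ((-t : ℝ) : ℂ) * Complex.I = -Complex.I * t by push_cast; ring] at this
    refine PhragmenLindelof.quadrant_I (f := fun w => F (c * w ^ 2)) (C := B)
      (hF.comp (by fun_prop)).diffContOnCl ⟨1, by norm_num, C, ?_⟩ (fun x _ => ?_) (fun x _ => ?_)
      hw1 hw2
    · refine Asymptotics.IsBigO.of_bound C ?_
      refine Filter.Eventually.filter_mono inf_le_left ?_
      have hlarge : ∀ᶠ z : ℂ in Bornology.cobounded ℂ, K ≤ ‖z‖ :=
        tendsto_norm_cobounded_atTop.eventually_ge_atTop K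
      filter_upwards [hlarge] with w hw
      obtain ⟨k, hk, hk0⟩ := exists_sq_eq_neg (c * w ^ 2)
      have hkn : ‖k‖ = ‖w‖ := by
        have := congrArg norm hk
        rw [norm_neg, norm_pow, norm_mul, hcn, one_mul, norm_pow] at this
        exact (pow_left_inj₀ (norm_nonneg _) (norm_nonneg _) two_ne_zero).1 this
      have := hgrow k hk0 (by rw [hkn]; exact hw)
      rw [hk, hkn] at this
      rwa [Real.rpow_one, Real.norm_of_nonneg (Real.exp_pos _).le]
    · have := haxis' (x ^ 2)
      simpa using this
    · have := haxis' (-x ^ 2)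
      rw [show c * ((-x ^ 2 : ℝ) : ℂ) = c * (x * Complex.I) ^ 2 by
        rw [mul_pow, Complex.I_sq]; push_cast; ring] at this
      exact this
  rcases le_total 0 z.re with h | h
  · obtain ⟨w, hw, h1, h2⟩ := exists_sq_eq_quadrant (z := Complex.I * z) (by simpa using h)
    have := key (-Complex.I) (Or.inr rfl) w h1 h2
    rwa [hw, ← mul_assoc, neg_mul, Complex.I_mul_I, neg_neg, one_mul] at this
  · obtain ⟨w, hw, h1, h2⟩ := exists_sq_eq_quadrant (z := -Complex.I * z) (by simpa using h)
    have := key Complex.I (Or.inl rfl) w h1 h2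
    rwa [hw, ← mul_assoc, mul_neg, Complex.I_mul_I, neg_neg, one_mul] at this

/-- The limit makes F bounded far out on the imaginary axis and compactness handles the rest. Hence
F is bounded, so constant by Liouville, and the constant equals the limit. -/
theorem eq_zero_of_growth_of_tendsto {F : ℂ → ℂ} (hF : Differentiable ℂ F) {C K : ℝ}
    (hgrow : ∀ k : ℂ, 0 ≤ k.re → K ≤ ‖k‖ → ‖F (-k ^ 2)‖ ≤ C * Real.exp (C * ‖k‖))
    (hlim : Tendsto (fun k : ℂ => F (-k ^ 2)) (comap Complex.re atTop) (𝓝 0)) (z : ℂ) :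
    F z = 0 := by
  have hev : ∀ᶠ k : ℂ in comap Complex.re atTop, ‖F (-k ^ 2)‖ ≤ 1 := by
    have := hlim.norm.eventually (eventually_le_nhds (b := (1 : ℝ)) (by simp))
    exact this
  rw [eventually_comap] at hev
  obtain ⟨R, hR⟩ := eventually_atTop.1 hev
  have hbd : ∃ B, ∀ t : ℝ, ‖F (t * Complex.I)‖ ≤ B := by
    have hcont : Continuous fun t : ℝ => F (t * Complex.I) := hF.continuous.comp (by fun_prop)
    obtain ⟨B, hB⟩ := (isCompact_Icc (a := -(2 * R ^ 2)) (b := 2 * R ^ 2)).exists_bound_of_continuousOn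
      hcont.continuousOn
    refine ⟨max B 1, fun t => ?_⟩
    by_cases ht : t ∈ Icc (-(2 * R ^ 2)) (2 * R ^ 2)
    · exact (hB t ht).trans (le_max_left _ _)
    · refine le_trans ?_ (le_max_right _ _)
      have habs : 2 * R ^ 2 < |t| := by
        by_contra hcon
        exact ht (abs_le.1 (not_lt.1 hcon))
      -- The point it equals -k² for k = √(|t|/2)(1 ∓ i), whose real part is √(|t|/2).
      have hs : R ≤ Real.sqrt (|t| / 2) := Real.le_sqrt_of_sq_le (by linarith)
      have hsq : ((Real.sqrt (|t| / 2) : ℝ) : ℂ) ^ 2 = ((|t| / 2 : ℝ) : ℂ) := by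
        rw [← Complex.ofReal_pow, Real.sq_sqrt (by positivity)]
      rcases le_total 0 t with h0 | h0
      · have := hR _ hs (Real.sqrt (|t| / 2) * (1 - Complex.I)) (by simp)
        rw [mul_pow, hsq, abs_of_nonneg h0, show (1 - Complex.I) ^ 2 = -2 * Complex.I by
          ring_nf; rw [Complex.I_sq]; ring] at this
        rw [show -(((t / 2 : ℝ) : ℂ) * (-2 * Complex.I)) = t * Complex.I by push_cast; ring] at this
        exact this
      · have := hR _ hs (Real.sqrt (|t| / 2) * (1 + Complex.I)) (by simp)
        rw [mul_pow, hsq, abs_of_nonpos h0, show (1 + Complex.I) ^ 2 = 2 * Complex.I by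
          ring_nf; rw [Complex.I_sq]; ring] at this
        rw [show -(((-t / 2 : ℝ) : ℂ) * (2 * Complex.I)) = t * Complex.I by push_cast; ring] at this
        exact this
  obtain ⟨B, hB⟩ := hbd
  have hbounded : Bornology.IsBounded (range F) :=
    isBounded_iff_forall_norm_le.2 ⟨B, by
      rintro _ ⟨w, rfl⟩
      exact bounded_of_bounded_on_rays hF hgrow hB w⟩
  have hconst : ∀ w, F w = F z := fun w => hF.apply_eq_apply_of_bounded hbounded w z
  simp_rw [hconst] at hlim
  have : (comap Complex.re atTop : Filter ℂ).NeBot :=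
    atTop_neBot.comap_of_surj Complex.re_surjective
  exact tendsto_nhds_unique tendsto_const_nhds hlim

/-! ### Equality of potentials from proportional solutions -/

/-- Differentiate zỹ - yz̃ = 0 three times. The second derivative gives z'ỹ' - y'z̃' = 0, and the
third then gives (q - q̃)(z'ỹ - y'z̃) = 0. -/
theorem SLSol.potential_ae_eq {q qt : ℝ → ℝ} {lam : ℂ} {a b : ℝ}
    {y y' z z' yt yt' zt zt' : ℝ → ℂ} (hab : a ≤ b)
    (hy : SLSol q lam a b y y') (hz : SLSol q lam a b z z')
    (hyt : SLSol qt lam a b yt yt') (hzt : SLSol qt lam a b zt zt')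
    (hW : ∀ x ∈ Icc a b, y x * z' x - y' x * z x ≠ 0)
    (hWt : ∀ x ∈ Icc a b, yt x * zt' x - yt' x * zt x ≠ 0)
    (hprop : ∀ x ∈ Icc a b, z x * yt x - y x * zt x = 0) :
    ∀ᵐ x, x ∈ Ioo a b → q x = qt x := by
  have hzero : ∀ {f : ℝ → ℂ} {d : ℂ} {x : ℝ}, x ∈ Ioo a b → (∀ t ∈ Ioo a b, f t = 0) →
      HasDerivAt f d x → d = 0 := by
    intro f d x hx hf hd
    have h0 : f =ᶠ[𝓝 x] fun _ => 0 := by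
      filter_upwards [Ioo_mem_nhds hx.1 hx.2] with t ht using hf t ht
    exact hd.unique ((hasDerivAt_const x (0 : ℂ)).congr_of_eventuallyEq h0)
  have h1 : ∀ x ∈ Ioo a b, (z' x * yt x - y' x * zt x) + (z x * yt' x - y x * zt' x) = 0 := by
    intro x hx
    have := hzero hx (fun t ht => hprop t (Ioo_subset_Icc_self ht))
      (((hz.hasDerivAt hx).mul (hyt.hasDerivAt hx)).sub
        ((hy.hasDerivAt hx).mul (hzt.hasDerivAt hx)))
    linear_combination this
  have h2ae : ∀ᵐ x, x ∈ Ioo a b → z' x * yt' x - y' x * zt' x = 0 := by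
    filter_upwards [hy.ae, hz.ae, hyt.ae, hzt.ae] with x a1 a2 a3 a4 hx
    have := hzero hx h1
      ((((a2 hx).mul (hyt.hasDerivAt hx)).sub ((a1 hx).mul (hzt.hasDerivAt hx))).add
        (((hz.hasDerivAt hx).mul (a3 hx)).sub ((hy.hasDerivAt hx).mul (a4 hx))))
    have e := hprop x (Ioo_subset_Icc_self hx)
    linear_combination (1 / 2 : ℂ) * this - (1 / 2 : ℂ) * ((q x - lam) + (qt x - lam)) * e
  -- Continuity upgrades the a.e. identity to every point, so that it can be differentiated once
  -- more.
  have h2 : ∀ x ∈ Ioo a b, z' x * yt' x - y' x * zt' x = 0 := by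
    refine Measure.eqOn_open_of_ae_eq (μ := volume) (g := fun _ => (0 : ℂ))
      ((ae_restrict_iff' measurableSet_Ioo).2 h2ae) isOpen_Ioo ?_ continuousOn_const
    exact (((hz.continuousOn' hab).mul (hyt.continuousOn' hab)).sub
      ((hy.continuousOn' hab).mul (hzt.continuousOn' hab))).mono Ioo_subset_Icc_self
  filter_upwards [hy.ae, hz.ae, hyt.ae, hzt.ae] with x a1 a2 a3 a4 hx
  have hx' := Ioo_subset_Icc_self hx
  have h3 := hzero hx h2 (((a2 hx).mul (a3 hx)).sub ((a1 hx).mul (a4 hx)))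
  have e1 := h1 x hx
  have e0 := hprop x hx'
  have e2 := h2 x hx
  -- The 2 × 2 determinant formed from these mixed products is, up to sign, the product of the two
  -- Wronskians. If this entry vanished, the first row and then the determinant would vanish.
  have hdet : (z' x * yt x - y' x * zt x) ≠ 0 := by
    intro h0
    have h0' : z x * yt' x - y x * zt' x = 0 := by rw [h0, zero_add] at e1; exact e1
    refine mul_ne_zero (hW x hx') (hWt x hx') ?_
    linear_combination (z' x * yt' x - y' x * zt' x) * e0 - (z x * yt' x - y x * zt' x) * h0
  have h4 : ((q x : ℂ) - qt x) * (z' x * yt x - y' x * zt x) = 0 := by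
    linear_combination (-1 : ℂ) * h3 + ((q x : ℂ) - lam) * e1
  have h5 := (mul_eq_zero.1 h4).resolve_right hdet
  exact_mod_cast sub_eq_zero.1 h5

/-! ### Solutions with transfer condition, from their initial data -/

section TransferSol

variable {S : ℝ} {M : Matrix (Fin 2) (Fin 2) ℝ} {q : ℝ → ℝ}

/-- The right part of the solution with initial data `c`, `c'` at `-S`. -/
noncomputable def transferSol (S : ℝ) (M : Matrix (Fin 2) (Fin 2) ℝ) (q : ℝ → ℝ) (lam c c' : ℂ) :
    ℝ → ℂ :=
  slSol q lam 0 (M 0 0 * slSol q lam (-S) c c' 0 + M 0 1 * slSol' q lam (-S) c c' 0)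
    (M 1 0 * slSol q lam (-S) c c' 0 + M 1 1 * slSol' q lam (-S) c c' 0)

/-- The derivative of `transferSol`. -/
noncomputable def transferSol' (S : ℝ) (M : Matrix (Fin 2) (Fin 2) ℝ) (q : ℝ → ℝ) (lam c c' : ℂ) :
    ℝ → ℂ :=
  slSol' q lam 0 (M 0 0 * slSol q lam (-S) c c' 0 + M 0 1 * slSol' q lam (-S) c c' 0)
    (M 1 0 * slSol q lam (-S) c c' 0 + M 1 1 * slSol' q lam (-S) c c' 0)

theorem transferSol_isTSol (hS : 0 ≤ S) (hql : IntervalIntegrable q volume (-S) 0)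
    (hqr : IntervalIntegrable q volume 0 S) (lam c c' : ℂ) :
    TSol S M q lam (slSol q lam (-S) c c') (slSol' q lam (-S) c c')
      (transferSol S M q lam c c') (transferSol' S M q lam c c') where
  left := slSol_isSol (by linarith) hql lam c c'
  right := slSol_isSol hS hqr lam _ _
  match_val := slSol_left hS hqr _ _ _
  match_deriv := slSol'_left _ _ _

theorem slSol_differentiable_const {a b : ℝ} (hq : IntervalIntegrable q volume a b) (c c' : ℂ)
    {x : ℝ} (hx : x ∈ Icc a b) : Differentiable ℂ fun lam => slSol q lam a c c' x :=
  slSol_differentiable hq (differentiable_const c) (differentiable_const c') hx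

theorem transferSol_differentiable (hS : 0 ≤ S) (hql : IntervalIntegrable q volume (-S) 0)
    (hqr : IntervalIntegrable q volume 0 S) (c c' : ℂ) {x : ℝ} (hx : x ∈ Icc 0 S) :
    Differentiable ℂ fun lam => transferSol S M q lam c c' x := by
  have h0 : (0 : ℝ) ∈ Icc (-S) 0 := ⟨by linarith, le_rfl⟩
  have h1 := slSol_differentiable_const hql c c' h0
  have h2 : Differentiable ℂ fun lam => slSol' q lam (-S) c c' 0 :=
    slSol'_differentiable hql (differentiable_const c) (differentiable_const c') h0
  exact slSol_differentiable hqr ((h1.const_mul _).add (h2.const_mul _))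
    ((h1.const_mul _).add (h2.const_mul _)) hx

/-- Glues a left and a right part at `0`. -/
noncomputable def glueAtZero (yl yr : ℝ → ℂ) (x : ℝ) : ℂ := if x < 0 then yl x else yr x

theorem SLSol.solvesSLOn {lam : ℂ} {a b : ℝ} {y y' z z' : ℝ → ℂ} {I : Set ℝ}
    (h : SLSol q lam a b y y') (hab : a ≤ b) (hI : I ⊆ Icc a b) (hIm : MeasurableSet I)
    (hz : ∀ x ∈ I, z x = y x) (hz' : ∀ x ∈ I, z' x = y' x) (hc : I.OrdConnected) :
    SolvesSLOn q lam I z z' := by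
  refine ⟨fun x hx => ?_, fun c hc' d hd => ?_, ?_⟩
  · rw [hz' x hx]
    exact ((h.hasDeriv x (hI hx)).mono hI).congr hz (hz x hx)
  · refine (h.ac.mono ?_).congr fun x hx => (hz' x (hc.uIcc_subset hc' hd hx)).symm
    rw [uIcc_of_le hab]
    exact (hc.uIcc_subset hc' hd).trans hI
  · rw [ae_restrict_iff' hIm]
    filter_upwards [ae_mem_Ioo_imp_of_Icc h.ae] with x hx hm
    refine ⟨((q x : ℂ) - lam) * y x, ?_, by rw [hz x hm]; ring⟩
    exact (hx (hI hm)).hasDerivWithinAt.congr hz' (hz' x hm)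

theorem TSol.isTransferSolution {lam : ℂ} {yl yl' yr yr' : ℝ → ℂ} (hS : 0 < S)
    (h : TSol S M q lam yl yl' yr yr') :
    IsTransferSolution S M q lam (glueAtZero yl yr) (glueAtZero yl' yr') where
  left := h.left.solvesSLOn (by linarith) Ico_subset_Icc_self measurableSet_Ico
    (fun x hx => if_pos hx.2) (fun x hx => if_pos hx.2) ordConnected_Ico
  right := h.right.solvesSLOn hS.le Ioc_subset_Icc_self measurableSet_Ioc
    (fun x hx => if_neg (not_lt.2 hx.1.le)) (fun x hx => if_neg (not_lt.2 hx.1.le))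
    ordConnected_Ioc
  transfer := by
    have hl : ∀ f g : ℝ → ℂ, ContinuousOn f (Icc (-S) 0) →
        Tendsto (glueAtZero f g) (𝓝[<] 0) (𝓝 (f 0)) := fun f g hf => by
      have h1 : Tendsto f (𝓝[<] 0) (𝓝 (f 0)) := by
        have := hf 0 ⟨by linarith, le_rfl⟩
        refine this.mono_left ?_
        rw [← nhdsWithin_Ico_eq_nhdsLT (by linarith : -S < 0)]
        exact nhdsWithin_mono _ Ico_subset_Icc_self
      refine h1.congr' ?_
      filter_upwards [self_mem_nhdsWithin] with x hx
      exact (if_pos hx).symm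
    have hr : ∀ f g : ℝ → ℂ, ContinuousOn g (Icc 0 S) →
        Tendsto (glueAtZero f g) (𝓝[>] 0) (𝓝 (g 0)) := fun f g hg => by
      have h1 : Tendsto g (𝓝[>] 0) (𝓝 (g 0)) := by
        have := hg 0 ⟨le_rfl, hS.le⟩
        refine this.mono_left ?_
        rw [← nhdsWithin_Ioc_eq_nhdsGT hS]
        exact nhdsWithin_mono _ Ioc_subset_Icc_self
      refine h1.congr' ?_
      filter_upwards [self_mem_nhdsWithin] with x hx
      exact (if_neg (not_lt.2 (le_of_lt hx))).symm
    exact ⟨yl 0, yl' 0, yr 0, yr' 0, hl _ _ h.left.continuousOn,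
      hl _ _ (h.left.continuousOn' (by linarith)), hr _ _ h.right.continuousOn,
      hr _ _ (h.right.continuousOn' hS.le), h.match_val, h.match_deriv⟩

/-- The definition of m quantifies over all solutions on the punctured interval; here it is applied
to the glued Picard solutions. -/
theorem IsTitchmarshWeylM.weyl_solution {m : ℂ → ℂ} (hm : IsTitchmarshWeylM S M q m) (hS : 0 < S)
    (hql : IntervalIntegrable q volume (-S) 0) (hqr : IntervalIntegrable q volume 0 S) {lam : ℂ}
    (h0 : transferSol S M q lam 0 1 S ≠ 0) :
    transferSol S M q lam (-1) 0 S + m lam * transferSol S M q lam 0 1 S = 0 := by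
  have hneg : -S < 0 := by linarith
  have hS' : ¬S < 0 := not_lt.2 hS.le
  have := hm lam _ _ _ _ ((transferSol_isTSol hS.le hql hqr lam (-1) 0).isTransferSolution hS)
    (by simp only [glueAtZero, if_pos hneg]; exact slSol_left hneg.le hql _ _ _)
    (by simp [glueAtZero, hneg])
    ((transferSol_isTSol hS.le hql hqr lam 0 1).isTransferSolution hS)
    (by simp only [glueAtZero, if_pos hneg]; exact slSol_left hneg.le hql _ _ _)
    (by simp [glueAtZero, hneg])
  simp only [glueAtZero, if_neg hS'] at this
  exact this h0

end TransferSol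

/-! ### Growth and decay in the spectral parameter -/

section Bounds

variable {S : ℝ} {M : Matrix (Fin 2) (Fin 2) ℝ} {q : ℝ → ℝ}

theorem transferGrowth_le_exp (M : Matrix (Fin 2) (Fin 2) ℝ) (k : ℂ) :
    transferGrowth M k ≤ (1 + |M 0 1|) * Real.exp ‖k‖ := by
  have h1 : 1 ≤ Real.exp ‖k‖ := Real.one_le_exp (norm_nonneg _)
  have h2 : ‖k‖ ≤ Real.exp ‖k‖ := by linarith [Real.add_one_le_exp ‖k‖]
  have h3 := mul_le_mul_of_nonneg_left h2 (abs_nonneg (M 0 1))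
  unfold transferGrowth
  linarith

/-- Solutions with fixed initial data grow at most exponentially in `k`. -/
theorem exists_growth_bound (hS : 0 < S) (hql : IntervalIntegrable q volume (-S) 0)
    (hqr : IntervalIntegrable q volume 0 S) (c c' : ℂ) :
    ∃ C K : ℝ, 0 ≤ C ∧ ∀ k : ℂ, 0 ≤ k.re → K ≤ ‖k‖ →
      (∀ x ∈ Icc (-S) 0, ‖slSol q (-k ^ 2) (-S) c c' x‖ ≤ C * Real.exp (C * ‖k‖)) ∧
      (∀ x ∈ Icc 0 S, ‖transferSol S M q (-k ^ 2) c c' x‖ ≤ C * Real.exp (C * ‖k‖)) := by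
  set Q := max (∫ t in (-S)..0, ‖q t‖) (∫ t in (0 : ℝ)..S, ‖q t‖) with hQ
  set B := 2 * (‖c'‖ + ‖c‖) with hB
  have hB0 : 0 ≤ B := by positivity
  have hm := one_le_matchConst M
  set G := 2 * matchConst M * (1 + |M 0 1|) * B with hG
  have hG0 : 0 ≤ G := by positivity
  -- One constant serves as both prefactor and exponent: B and G are the prefactors, 2S bounds x +
  -- S, and the 1 pays for `transferGrowth`.
  refine ⟨B + G + (1 + 2 * S), max 1 (2 * Q), by positivity, fun k hk hK => ?_⟩
  have hk1 : 1 ≤ ‖k‖ := (le_max_left _ _).trans hK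
  have hkpos : 0 < ‖k‖ := by linarith
  obtain ⟨h1, h2⟩ := (transferSol_isTSol (M := M) hS.le hql hqr (-k ^ 2) c c').forward_bound hS.le
    hql hqr (le_max_left _ _) (le_max_right _ _) hk hk1 ((le_max_right _ _).trans hK)
  have hA : diagNorm k (slSol q (-k ^ 2) (-S) c c' (-S)) (slSol' q (-k ^ 2) (-S) c c' (-S)) / ‖k‖
      ≤ B := by
    rw [slSol_left (by linarith) hql, slSol'_left, div_le_iff₀ hkpos]
    refine (diagNorm_le _ _ _).trans ?_
    nlinarith [norm_nonneg c, norm_nonneg c']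
  have hre : k.re ≤ ‖k‖ := (le_abs_self _).trans (Complex.abs_re_le_norm k)
  have hx : ∀ x ≤ S, Real.exp (k.re * (x + S)) ≤ Real.exp (2 * S * ‖k‖) := fun x hx => by
    refine Real.exp_le_exp.2 ?_
    nlinarith [mul_le_mul_of_nonneg_left hx hk, mul_le_mul_of_nonneg_left hre hS.le]
  have hA0 : 0 ≤ diagNorm k (slSol q (-k ^ 2) (-S) c c' (-S))
      (slSol' q (-k ^ 2) (-S) c c' (-S)) / ‖k‖ := div_nonneg (diagNorm_nonneg _ _ _) hkpos.le
  have hE : Real.exp (2 * S * ‖k‖) * Real.exp ‖k‖ ≤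
      Real.exp ((B + G + (1 + 2 * S)) * ‖k‖) := by
    rw [← Real.exp_add]
    refine Real.exp_le_exp.2 ?_
    nlinarith [mul_nonneg (add_nonneg hB0 hG0) hkpos.le]
  have hek : 1 ≤ Real.exp ‖k‖ := Real.one_le_exp hkpos.le
  have hE' : Real.exp (2 * S * ‖k‖) ≤ Real.exp ((B + G + (1 + 2 * S)) * ‖k‖) :=
    (le_mul_of_one_le_right (Real.exp_pos _).le hek).trans hE
  refine ⟨fun x hx' => (h1 x hx').trans ?_, fun x hx' => (h2 x hx').trans ?_⟩
  · calc _ ≤ Real.exp (2 * S * ‖k‖) * B :=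
        mul_le_mul (hx x (hx'.2.trans hS.le)) hA hA0 (Real.exp_pos _).le
      _ ≤ Real.exp ((B + G + (1 + 2 * S)) * ‖k‖) * (B + G + (1 + 2 * S)) :=
        mul_le_mul hE' (by linarith) hB0 (Real.exp_pos _).le
      _ = _ := mul_comm _ _
  · have h3 := mul_le_mul (hx x hx'.2) hA hA0 (Real.exp_pos _).le
    calc _ ≤ 2 * matchConst M * ((1 + |M 0 1|) * Real.exp ‖k‖) *
          (Real.exp (2 * S * ‖k‖) * B) := by
          refine mul_le_mul (mul_le_mul_of_nonneg_left (transferGrowth_le_exp M k) (by linarith))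
            h3 (mul_nonneg (Real.exp_pos _).le hA0) (by positivity)
      _ = (Real.exp (2 * S * ‖k‖) * Real.exp ‖k‖) * G := by rw [hG]; ring
      _ ≤ Real.exp ((B + G + (1 + 2 * S)) * ‖k‖) * (B + G + (1 + 2 * S)) :=
        mul_le_mul hE (by linarith) hG0 (Real.exp_pos _).le
      _ = _ := mul_comm _ _

/-- Bounds for the solution vanishing at `-S` and for the Weyl solution, whose product decays. -/
theorem exists_decay_bound (hS : 0 < S) (hM : 0 < M.det)
    (hql : IntervalIntegrable q volume (-S) 0) (hqr : IntervalIntegrable q volume 0 S) :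
    ∃ C : ℝ, 0 ≤ C ∧ ∀ᶠ k : ℂ in comap Complex.re atTop,
      transferSol S M q (-k ^ 2) 0 1 S ≠ 0 ∧
      (∀ x ∈ Icc (-S) 0, ‖slSol q (-k ^ 2) (-S) 0 1 x‖ ≤
        C * (Real.exp (k.re * (x + S)) / ‖k‖)) ∧
      (∀ x ∈ Icc 0 S, ‖transferSol S M q (-k ^ 2) 0 1 x‖ ≤
        C * (transferGrowth M k * (Real.exp (k.re * (x + S)) / ‖k‖))) ∧
      ∀ yl yl' yr yr', TSol S M q (-k ^ 2) yl yl' yr yr' → yl (-S) = -1 → yr S = 0 →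
        (∀ x ∈ Icc (-S) 0, ‖yl x‖ ≤ C * (Real.exp (k.re * (x + S)))⁻¹) ∧
        (∀ x ∈ Icc 0 S, ‖yr x‖ ≤
          C * ((Real.exp (k.re * (x + S)))⁻¹ / transferGrowth M k)) := by
  set Q := max (∫ t in (-S)..0, ‖q t‖) (∫ t in (0 : ℝ)..S, ‖q t‖) with hQ
  have hsol : ∀ k : ℂ, TSol S M q (-k ^ 2) _ _ _ _ := fun k =>
    transferSol_isTSol (M := M) hS.le hql hqr (-k ^ 2) 0 1
  have hleft : ∀ k : ℂ, slSol q (-k ^ 2) (-S) 0 1 (-S) = 0 := fun k =>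
    slSol_left (by linarith) hql _ _ _
  obtain ⟨c, hc, hev⟩ := TSol.eventually_le_norm_right hS hM hql hqr hsol hleft
    (fun k => slSol'_left _ _ _)
  have hm := one_le_matchConst M
  have hm' := one_le_matchConst (reflectedMatrix M)
  set C₁ := 4 * matchConst M with hC₁
  set C₂ := 2 * M.det / c with hC₂
  set C₃ := 2 * matchConst (reflectedMatrix M) * (1 + 1 / M.det) * C₂ with hC₃
  have hC₁0 : 0 ≤ C₁ := by positivity
  have hC₂0 : 0 ≤ C₂ := by positivity
  have hC₃0 : 0 ≤ C₃ := by positivity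
  refine ⟨2 + C₁ + C₂ + C₃, by positivity, ?_⟩
  filter_upwards [hev, tendsto_comap.eventually_ge_atTop (0 : ℝ),
    tendsto_norm_comap_re.eventually_ge_atTop 1,
    tendsto_norm_comap_re.eventually_ge_atTop (2 * Q)] with k hk hk0 hk1 hkQ
  have hkpos : 0 < ‖k‖ := by linarith
  have hD := one_le_transferGrowth M k
  have hDpos : 0 < transferGrowth M k := by linarith
  have hne : transferSol S M q (-k ^ 2) 0 1 S ≠ 0 :=
    norm_pos_iff.1 (lt_of_lt_of_le (by positivity) hk)
  obtain ⟨h1, h2⟩ := (hsol k).forward_bound hS.le hql hqr (le_max_left _ _) (le_max_right _ _) hk0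
    hk1 hkQ
  rw [hleft, slSol'_left] at h1 h2
  have hA : diagNorm k 0 1 = 2 := by simp [diagNorm]; norm_num
  rw [hA] at h1 h2
  refine ⟨hne, fun x hx => (h1 x hx).trans ?_, fun x hx => (h2 x hx).trans ?_,
    fun yl yl' yr yr' hy hy1 hy2 => ?_⟩
  · calc _ = 2 * (Real.exp (k.re * (x + S)) / ‖k‖) := by ring
      _ ≤ _ := mul_le_mul_of_nonneg_right (by linarith) (by positivity)
  · calc _ = C₁ * (transferGrowth M k * (Real.exp (k.re * (x + S)) / ‖k‖)) := by
          rw [hC₁]; ring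
      _ ≤ _ := mul_le_mul_of_nonneg_right (by linarith) (by positivity)
  -- As ψ(S) = 0, the Wronskian with w₂ at S reduces to ψ'(S) w₂(S) = det M, which makes ψ'(S) small
  -- because w₂(S) is large.
  · have hW := hy.wronskian_right hS.le (hsol k) (right_mem_Icc.2 hS.le)
    rw [hy2, hy1, hleft, slSol'_left] at hW
    have hW' : ‖yr' S‖ * ‖transferSol S M q (-k ^ 2) 0 1 S‖ = M.det := by
      rw [← norm_mul]
      have : yr' S * transferSol S M q (-k ^ 2) 0 1 S = M.det := by linear_combination -hW
      rw [this, Complex.norm_real, Real.norm_of_nonneg hM.le]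
    have hβ : diagNorm k (yr S) (yr' S) / ‖k‖ ≤
        C₂ * ((Real.exp (k.re * (2 * S)))⁻¹ / transferGrowth M k) := by
      have h3 := mul_le_mul_of_nonneg_left hk (norm_nonneg (yr' S))
      rw [hW'] at h3
      have h4 : diagNorm k (yr S) (yr' S) = 2 * ‖yr' S‖ := by
        rw [hy2]; simp [diagNorm]; ring
      rw [h4, hC₂]
      have hE := Real.exp_pos (k.re * (2 * S))
      rw [div_le_iff₀ hkpos]
      have h5 : ‖yr' S‖ ≤ M.det * ‖k‖ / (c * (Real.exp (k.re * (2 * S)) * transferGrowth M k)) := by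
        rw [le_div_iff₀ (by positivity)]
        have := mul_le_mul_of_nonneg_right h3 hkpos.le
        refine le_trans (le_of_eq ?_) this
        field_simp
      calc 2 * ‖yr' S‖ ≤ 2 * (M.det * ‖k‖ /
            (c * (Real.exp (k.re * (2 * S)) * transferGrowth M k))) := by linarith
        _ = _ := by field_simp
    obtain ⟨b1, b2⟩ := hy.backward_bound hS.le hM hql hqr (le_max_left _ _) (le_max_right _ _)
      hk0 hk1 hkQ
    have hexp : ∀ x : ℝ, Real.exp (k.re * (S - x)) * (Real.exp (k.re * (2 * S)))⁻¹ =
        (Real.exp (k.re * (x + S)))⁻¹ := fun x => by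
      rw [← Real.exp_neg, ← Real.exp_neg, ← Real.exp_add]; congr 1; ring
    refine ⟨fun x hx => (b2 x hx).trans ?_, fun x hx => (b1 x hx).trans ?_⟩
    -- Crossing 0 backwards costs a factor `transferGrowth`, which cancels the one gained from the
    -- size of w₂(S).
    · have h6 : 0 < M.det := hM
      calc _ ≤ 2 * matchConst (reflectedMatrix M) * ((1 + 1 / M.det) * transferGrowth M k) *
            (Real.exp (k.re * (S - x)) *
              (C₂ * ((Real.exp (k.re * (2 * S)))⁻¹ / transferGrowth M k))) := by gcongr
        _ = C₃ * (Real.exp (k.re * (S - x)) * (Real.exp (k.re * (2 * S)))⁻¹) := by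
          rw [hC₃]; field_simp
        _ = C₃ * (Real.exp (k.re * (x + S)))⁻¹ := by rw [hexp]
        _ ≤ _ := mul_le_mul_of_nonneg_right (by linarith) (by positivity)
    · calc _ ≤ Real.exp (k.re * (S - x)) *
            (C₂ * ((Real.exp (k.re * (2 * S)))⁻¹ / transferGrowth M k)) := by gcongr
        _ = C₂ * ((Real.exp (k.re * (S - x)) * (Real.exp (k.re * (2 * S)))⁻¹) /
            transferGrowth M k) := by ring
        _ = C₂ * ((Real.exp (k.re * (x + S)))⁻¹ / transferGrowth M k) := by rw [hexp]
        _ ≤ _ := mul_le_mul_of_nonneg_right (by linarith) (by positivity)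

end Bounds

/-! ### Vanishing of the cross products -/

section Uniqueness

variable {S : ℝ} {M : Matrix (Fin 2) (Fin 2) ℝ} {q qt : ℝ → ℝ}

/-- Each product pairs a growing with a decaying factor, so E and B cancel and only 1/k is left. -/
theorem norm_mul_sub_mul_le {A B C C' E k : ℝ} {f f' g g' : ℂ} (hE : 0 < E) (hk : 0 < k)
    (hC : 0 ≤ C) (hB : 0 < B) (hA : A = B * (E / k))
    (hf : ‖f‖ ≤ C * A) (hf' : ‖f'‖ ≤ C' * A) (hg : ‖g‖ ≤ C * (E⁻¹ / B))
    (hg' : ‖g'‖ ≤ C' * (E⁻¹ / B)) : ‖f * g' - g * f'‖ ≤ 2 * C * C' * k⁻¹ := by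
  have hA0 : 0 ≤ A := by rw [hA]; positivity
  have h1 : ‖f * g'‖ ≤ C * A * (C' * (E⁻¹ / B)) := by
    rw [norm_mul]; exact mul_le_mul hf hg' (norm_nonneg _) (by positivity)
  have h2 : ‖g * f'‖ ≤ C * (E⁻¹ / B) * (C' * A) := by
    rw [norm_mul]; exact mul_le_mul hg hf' (norm_nonneg _) (by positivity)
  refine (norm_sub_le _ _).trans ((add_le_add h1 h2).trans_eq ?_)
  rw [hA]; field_simp; ring

/-- Equal `m`-functions force the solution bases at each point to be proportional. -/
theorem cross_products_eq_zero (hS : 0 < S) (hM : 0 < M.det)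
    (hql : IntervalIntegrable q volume (-S) 0) (hqr : IntervalIntegrable q volume 0 S)
    (hqtl : IntervalIntegrable qt volume (-S) 0) (hqtr : IntervalIntegrable qt volume 0 S)
    {m : ℂ → ℂ} (hm : IsTitchmarshWeylM S M q m) (hmt : IsTitchmarshWeylM S M qt m) (lam : ℂ) :
    (∀ x ∈ Icc (-S) 0, slSol q lam (-S) 0 1 x * slSol qt lam (-S) (-1) 0 x -
      slSol q lam (-S) (-1) 0 x * slSol qt lam (-S) 0 1 x = 0) ∧
    (∀ x ∈ Icc 0 S, transferSol S M q lam 0 1 x * transferSol S M qt lam (-1) 0 x -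
      transferSol S M q lam (-1) 0 x * transferSol S M qt lam 0 1 x = 0) := by
  obtain ⟨C, hC, hdec⟩ := exists_decay_bound hS hM hql hqr
  obtain ⟨C', hC', hdec'⟩ := exists_decay_bound hS hM hqtl hqtr
  obtain ⟨C₁, K₁, hC₁, hg₁⟩ := exists_growth_bound (M := M) hS hql hqr 0 1
  obtain ⟨C₂, K₂, hC₂, hg₂⟩ := exists_growth_bound (M := M) hS hql hqr (-1) 0
  obtain ⟨C₃, K₃, hC₃, hg₃⟩ := exists_growth_bound (M := M) hS hqtl hqtr 0 1
  obtain ⟨C₄, K₄, hC₄, hg₄⟩ := exists_growth_bound (M := M) hS hqtl hqtr (-1) 0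
  set K := max (max K₁ K₂) (max K₃ K₄) with hK
  set G := C₁ * C₄ + C₂ * C₃ + (C₁ + C₂ + C₃ + C₄) with hG
  have hG0 : 0 ≤ G := by positivity
  have hgrow : ∀ (r : ℝ) (f f' g g' : ℂ), 0 ≤ r → ‖f‖ ≤ C₁ * Real.exp (C₁ * r) →
      ‖g‖ ≤ C₂ * Real.exp (C₂ * r) → ‖f'‖ ≤ C₃ * Real.exp (C₃ * r) →
      ‖g'‖ ≤ C₄ * Real.exp (C₄ * r) → ‖f * g' - g * f'‖ ≤ G * Real.exp (G * r) := by
    intro r f f' g g' hr hf hg hf' hg'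
    have h14 : ‖f * g'‖ ≤ C₁ * Real.exp (C₁ * r) * (C₄ * Real.exp (C₄ * r)) := by
      rw [norm_mul]; exact mul_le_mul hf hg' (norm_nonneg _) (by positivity)
    have h23 : ‖g * f'‖ ≤ C₂ * Real.exp (C₂ * r) * (C₃ * Real.exp (C₃ * r)) := by
      rw [norm_mul]; exact mul_le_mul hg hf' (norm_nonneg _) (by positivity)
    have e14 : Real.exp (C₁ * r) * Real.exp (C₄ * r) ≤ Real.exp (G * r) := by
      rw [← Real.exp_add, ← add_mul]
      refine Real.exp_le_exp.2 (mul_le_mul_of_nonneg_right ?_ hr)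
      have : 0 ≤ C₁ * C₄ + C₂ * C₃ := by positivity
      linarith
    have e23 : Real.exp (C₂ * r) * Real.exp (C₃ * r) ≤ Real.exp (G * r) := by
      rw [← Real.exp_add, ← add_mul]
      refine Real.exp_le_exp.2 (mul_le_mul_of_nonneg_right ?_ hr)
      have : 0 ≤ C₁ * C₄ + C₂ * C₃ := by positivity
      linarith
    calc ‖f * g' - g * f'‖ ≤ ‖f * g'‖ + ‖g * f'‖ := norm_sub_le _ _
      _ ≤ C₁ * C₄ * (Real.exp (C₁ * r) * Real.exp (C₄ * r)) +
          C₂ * C₃ * (Real.exp (C₂ * r) * Real.exp (C₃ * r)) := by linarith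
      _ ≤ C₁ * C₄ * Real.exp (G * r) + C₂ * C₃ * Real.exp (G * r) := by gcongr
      _ = (C₁ * C₄ + C₂ * C₃) * Real.exp (G * r) := by ring
      _ ≤ G * Real.exp (G * r) :=
        mul_le_mul_of_nonneg_right (by linarith) (Real.exp_pos _).le
  have hKle : ∀ k : ℂ, K ≤ ‖k‖ → K₁ ≤ ‖k‖ ∧ K₂ ≤ ‖k‖ ∧ K₃ ≤ ‖k‖ ∧ K₄ ≤ ‖k‖ := fun k hk =>
    ⟨((le_max_left _ _).trans (le_max_left _ _)).trans hk,
      ((le_max_right _ _).trans (le_max_left _ _)).trans hk,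
      ((le_max_left _ _).trans (le_max_right _ _)).trans hk,
      ((le_max_right _ _).trans (le_max_right _ _)).trans hk⟩
  have hsqz : Tendsto (fun k : ℂ => 2 * C * C' * ‖k‖⁻¹) (comap Complex.re atTop) (𝓝 0) := by
    have := tendsto_norm_comap_re.inv_tendsto_atTop.const_mul (2 * C * C')
    rw [mul_zero] at this
    exact this
  have hpos : ∀ᶠ k : ℂ in comap Complex.re atTop, 0 < ‖k‖ :=
    tendsto_norm_comap_re.eventually_gt_atTop 0
  have hweyl : ∀ {p : ℝ → ℝ}, IntervalIntegrable p volume (-S) 0 → IntervalIntegrable p volume 0 S →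
      ∀ k : ℂ, TSol S M p (-k ^ 2) _ _ _ _ := fun hpl hpr k =>
    (transferSol_isTSol (M := M) hS.le hpl hpr (-k ^ 2) (-1) 0).add
      ((transferSol_isTSol (M := M) hS.le hpl hpr (-k ^ 2) 0 1).const_mul (m (-k ^ 2)))
  have hinit : ∀ {p : ℝ → ℝ}, IntervalIntegrable p volume (-S) 0 → ∀ k : ℂ,
      slSol p (-k ^ 2) (-S) (-1) 0 (-S) + m (-k ^ 2) * slSol p (-k ^ 2) (-S) 0 1 (-S) = -1 := by
    intro p hp k
    rw [slSol_left (by linarith) hp, slSol_left (by linarith) hp]; ring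
  refine ⟨fun x hx => ?_, fun x hx => ?_⟩
  · refine eq_zero_of_growth_of_tendsto (F := fun lam => slSol q lam (-S) 0 1 x *
        slSol qt lam (-S) (-1) 0 x - slSol q lam (-S) (-1) 0 x * slSol qt lam (-S) 0 1 x)
      (C := G) (K := K) ?_ (fun k hk hkK => ?_) (squeeze_zero_norm' ?_ hsqz) lam
    · exact ((slSol_differentiable_const hql 0 1 hx).mul
        (slSol_differentiable_const hqtl (-1) 0 hx)).sub
        ((slSol_differentiable_const hql (-1) 0 hx).mul (slSol_differentiable_const hqtl 0 1 hx))
    · obtain ⟨k1, k2, k3, k4⟩ := hKle k hkK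
      exact hgrow ‖k‖ _ _ _ _ (norm_nonneg _) ((hg₁ k hk k1).1 x hx) ((hg₂ k hk k2).1 x hx)
        ((hg₃ k hk k3).1 x hx) ((hg₄ k hk k4).1 x hx)
    · filter_upwards [hdec, hdec', hpos] with k ⟨a1, a2, a3, a4⟩ ⟨b1, b2, b3, b4⟩ hk
      have c1 := (a4 _ _ _ _ (hweyl hql hqr k) (hinit hql k) (hm.weyl_solution hS hql hqr a1)).1 x hx
      have c2 := (b4 _ _ _ _ (hweyl hqtl hqtr k) (hinit hqtl k)
        (hmt.weyl_solution hS hqtl hqtr b1)).1 x hx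
      -- With ψ = w₁ + m w₂ and the same m for both potentials, w₂ψ̃ - ψw̃₂ equals the cross product
      -- of w₁ and w₂. On the left half no matching has occurred, hence B = 1.
      have := norm_mul_sub_mul_le (B := 1) (Real.exp_pos (k.re * (x + S))) hk hC one_pos
        (one_mul _).symm (a2 x hx) (b2 x hx) (by rwa [div_one]) (by rwa [div_one])
      refine le_trans (le_of_eq (congrArg norm ?_)) this
      ring
  · refine eq_zero_of_growth_of_tendsto (F := fun lam => transferSol S M q lam 0 1 x *
        transferSol S M qt lam (-1) 0 x -
          transferSol S M q lam (-1) 0 x * transferSol S M qt lam 0 1 x)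
      (C := G) (K := K) ?_ (fun k hk hkK => ?_) (squeeze_zero_norm' ?_ hsqz) lam
    · exact ((transferSol_differentiable hS.le hql hqr 0 1 hx).mul
        (transferSol_differentiable hS.le hqtl hqtr (-1) 0 hx)).sub
        ((transferSol_differentiable hS.le hql hqr (-1) 0 hx).mul
          (transferSol_differentiable hS.le hqtl hqtr 0 1 hx))
    · obtain ⟨k1, k2, k3, k4⟩ := hKle k hkK
      exact hgrow ‖k‖ _ _ _ _ (norm_nonneg _) ((hg₁ k hk k1).2 x hx) ((hg₂ k hk k2).2 x hx)
        ((hg₃ k hk k3).2 x hx) ((hg₄ k hk k4).2 x hx)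
    · filter_upwards [hdec, hdec', hpos] with k ⟨a1, a2, a3, a4⟩ ⟨b1, b2, b3, b4⟩ hk
      have c1 := (a4 _ _ _ _ (hweyl hql hqr k) (hinit hql k) (hm.weyl_solution hS hql hqr a1)).2 x hx
      have c2 := (b4 _ _ _ _ (hweyl hqtl hqtr k) (hinit hqtl k)
        (hmt.weyl_solution hS hqtl hqtr b1)).2 x hx
      have := norm_mul_sub_mul_le (Real.exp_pos (k.re * (x + S))) hk hC
        (zero_lt_one.trans_le (one_le_transferGrowth M k)) rfl (a3 x hx) (b3 x hx) c1 c2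
      refine le_trans (le_of_eq (congrArg norm ?_)) this
      ring

end Uniqueness

/-! ### The uniqueness theorem -/

theorem theorem4p2 (S : ℝ) (hS : 0 < S) (M : Matrix (Fin 2) (Fin 2) ℝ) (hM : 0 < M.det)
    (q qt : ℝ → ℝ)
    (hq : MemLp q 2 (volume.restrict (Icc (-S) S)))
    (hqt : MemLp qt 2 (volume.restrict (Icc (-S) S)))
    (m mt : ℂ → ℂ)
    (hm : IsTitchmarshWeylM S M q m) (hmt : IsTitchmarshWeylM S M qt mt)
    (heq : m = mt) :
    q =ᵐ[volume.restrict (Icc (-S) S)] qt := by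
  subst heq
  -- On a bounded interval L² lies in L¹, and integrability is all that the estimates require.
  have hint : ∀ {p : ℝ → ℝ}, MemLp p 2 (volume.restrict (Icc (-S) S)) →
      IntervalIntegrable p volume (-S) 0 ∧ IntervalIntegrable p volume 0 S := fun {p} hp => by
    have h1 : IntegrableOn p (Icc (-S) S) volume := hp.integrable one_le_two
    have h2 : IntervalIntegrable p volume (-S) S := by
      rw [intervalIntegrable_iff_integrableOn_Icc_of_le (by linarith)]; exact h1
    exact ⟨h2.mono_Icc ⟨le_rfl, by linarith⟩ ⟨by linarith, hS.le⟩,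
      h2.mono_Icc ⟨by linarith, hS.le⟩ ⟨by linarith, le_rfl⟩⟩
  obtain ⟨hql, hqr⟩ := hint hq
  obtain ⟨hqtl, hqtr⟩ := hint hqt
  have hneg : -S ≤ 0 := by linarith
  -- The cross products vanish for every λ, and a single value suffices to compare the potentials; λ
  -- = 0 is chosen.
  obtain ⟨hcl, hcr⟩ := cross_products_eq_zero hS hM hql hqr hqtl hqtr hm hmt 0
  have hWl : ∀ {p : ℝ → ℝ}, IntervalIntegrable p volume (-S) 0 → ∀ x ∈ Icc (-S) 0,
      slSol p 0 (-S) (-1) 0 x * slSol' p 0 (-S) 0 1 x -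
        slSol' p 0 (-S) (-1) 0 x * slSol p 0 (-S) 0 1 x ≠ 0 := fun hp x hx => by
    rw [(slSol_isSol hneg hp 0 (-1) 0).wronskian_eq hneg (slSol_isSol hneg hp 0 0 1) hx,
      slSol_left hneg hp, slSol_left hneg hp, slSol'_left, slSol'_left]
    norm_num
  have hWr : ∀ {p : ℝ → ℝ}, IntervalIntegrable p volume (-S) 0 → IntervalIntegrable p volume 0 S →
      ∀ x ∈ Icc 0 S, transferSol S M p 0 (-1) 0 x * transferSol' S M p 0 0 1 x -
        transferSol' S M p 0 (-1) 0 x * transferSol S M p 0 0 1 x ≠ 0 := fun hpl hpr x hx => by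
    rw [(transferSol_isTSol hS.le hpl hpr 0 (-1) 0).wronskian_right hS.le
      (transferSol_isTSol hS.le hpl hpr 0 0 1) hx,
      slSol_left hneg hpl, slSol_left hneg hpl, slSol'_left, slSol'_left]
    have : (M.det : ℂ) ≠ 0 := by exact_mod_cast hM.ne'
    simpa using this
  have hl := SLSol.potential_ae_eq hneg (slSol_isSol hneg hql 0 (-1) 0) (slSol_isSol hneg hql 0 0 1)
    (slSol_isSol hneg hqtl 0 (-1) 0) (slSol_isSol hneg hqtl 0 0 1) (hWl hql) (hWl hqtl) hcl
  have hr := SLSol.potential_ae_eq hS.le (transferSol_isTSol hS.le hql hqr 0 (-1) 0).right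
    (transferSol_isTSol hS.le hql hqr 0 0 1).right
    (transferSol_isTSol hS.le hqtl hqtr 0 (-1) 0).right
    (transferSol_isTSol hS.le hqtl hqtr 0 0 1).right (hWr hql hqr) (hWr hqtl hqtr) hcr
  refine (ae_restrict_iff' measurableSet_Icc).2 ?_
  filter_upwards [ae_mem_Ioo_imp_of_Icc hl, ae_mem_Ioo_imp_of_Icc hr] with x h1 h2 hx
  rcases le_total x 0 with h | h
  · exact h1 ⟨hx.1, h⟩
  · exact h2 ⟨h, hx.2⟩
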